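/- **Setting.** A (formal normal-play) game $G=\{G^L\mid G^R\}$ consists of a finite set of Left options $G^L$ and a finite set of Right options $G^R$, which are previously constructed games. Games carry the usual order ($G\le H$ iff no $G^L$ satisfies $H\le G^L$ and no $H^R$ satisfies $H^R\le G$), equality $G=H$ (meaning $G\le H$ and $H\le G$), negative $-G$, disjunctive sum $G+H$, and multiples $nG=G+\dots+G$ ($n$ summands). Each dyadic rational $x\in\mathbb Z[\frac12]$ is identified with the game that is its canonical form; a game equal to such a game is called a number. The stops are defined recursively: $L(G)=R(G)=x$ if $G$ is equal to the number $x$, and otherwise $L(G)=\max_{G^L}R(G^L)$ and $R(G)=\min_{G^R}L(G^R)$. For $t\in\mathbb Z[\frac12]$ define $\lambda_t(G),\rho_t(G)\in\mathbb Z[\frac12]$, the cooled game $G_t$ and the temperature $t(G)\in\mathbb Z[\frac12]\cup\{-\infty\}$ by simultaneous recursion. If $G$ is equal to an integer $n$, put $\lambda_t(G)=\rho_t(G)=n$, $G_t=n$, $t(G)=-\infty$. Otherwise put $$\tilde\lambda_t(G)=\max_{G^L}\{\rho_t(G^L)-t\},\quad \tilde\rho_t(G)=\min_{G^R}\{\lambda_t(G^R)+t\},\quad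 \tilde G_t=\{(G^L)_t-t\mid (G^R)_t+t\},$$ let $t(G)$ be the least $t\in\mathbb Z[\frac12]$ with $\tilde\lambda_t(G)=\tilde\rho_t(G)$ (it exists), and let $x$ be the common value of $\tilde\lambda_t(G)$ and $\tilde\rho_t(G)$ at $t=t(G)$. Then $(\lambda_t(G),\rho_t(G),G_t)$ is $(\tilde\lambda_t(G),\tilde\rho_t(G),\tilde G_t)$ for $t\le t(G)$ and $(x,x,x)$ for $t>t(G)$. **Corollary 7.5 (mean value).** Let $G$ be a game and let $t\in\mathbb Z[\frac12]$ with $t>t(G)$. Then $G_t$ is equal to a number, and this number is the mean value of $G$: $$\lim_{n\to\infty}\frac{L(nG)}{n}=G_t=\lim_{n\to\infty}\frac{R(nG)}{n}\quad\text{in }\mathbb R.$$ More precisely, there is a constant $C\in\mathbb Z[\frac12]$, which may depend on $t$ and $G$, such that $|nG-nG_t|\le C$, that is, $-C\le nG-nG_t\le C$ in the order of games, for all $n\in\mathbb N$. If $t\ge -1$, then $C=t+1$ has this property. -/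

import Mathlib

namespace CGT

/-! ### Dyadic rationals -/

/-- The ring `ℤ[1/2]` of dyadic rationals, as a subring of `ℚ`. -/
def dyadicSubring : Subring ℚ where
  carrier := {q | ∃ (k : ℤ) (m : ℕ), q = (k : ℚ) / 2 ^ m}
  zero_mem' := ⟨0, 0, by simp⟩
  one_mem' := ⟨1, 0, by simp⟩
  add_mem' := by
    rintro _ _ ⟨k, m, rfl⟩ ⟨l, n, rfl⟩
    refine ⟨k * 2 ^ n + l * 2 ^ m, m + n, ?_⟩
    push_cast
    rw [pow_add]
    field_simp
  mul_mem' := by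
    rintro _ _ ⟨k, m, rfl⟩ ⟨l, n, rfl⟩
    refine ⟨k * l, m + n, ?_⟩
    push_cast
    rw [pow_add]
    field_simp
  neg_mem' := by
    rintro _ ⟨k, m, rfl⟩
    exact ⟨-k, m, by push_cast; ring⟩

/-- The type `ℤ[1/2]`, with the ring structure and the order inherited from `ℚ`. -/
abbrev Dy : Type := dyadicSubring

/-- The maximum of a finite family of dyadic rationals (junk value `0` for the empty family). -/
noncomputable def maxOf {ι : Type} [Finite ι] (f : ι → Dy) : Dy :=
  open Classical in
  if h : Nonempty ι then
    letI := Fintype.ofFinite ι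
    Finset.univ.sup' (Finset.univ_nonempty_iff.mpr h) f
  else 0

/-- The minimum of a finite family of dyadic rationals (junk value `0` for the empty family). -/
noncomputable def minOf {ι : Type} [Finite ι] (f : ι → Dy) : Dy :=
  open Classical in
  if h : Nonempty ι then
    letI := Fintype.ofFinite ι
    Finset.univ.inf' (Finset.univ_nonempty_iff.mpr h) f
  else 0

/-! ### Formal games -/

/-- Formal normal-play games (finite, loop-free): a game is given by a finite family of Left
options and a finite family of Right options, which are games defined before. -/
inductive Game : Type 1
  | mk (α β : Type) (hα : Finite α) (hβ : Finite β) (L : α → Game) (R : β → Game) : Game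

namespace Game

/-- The index type of the Left options. -/
def LeftMoves : Game → Type
  | mk α _ _ _ _ _ => α

/-- The index type of the Right options. -/
def RightMoves : Game → Type
  | mk _ β _ _ _ _ => β

/-- The Left options `G^L`. -/
def moveLeft : (G : Game) → G.LeftMoves → Game
  | mk _ _ _ _ L _ => L

/-- The Right options `G^R`. -/
def moveRight : (G : Game) → G.RightMoves → Game
  | mk _ _ _ _ _ R => R

/-- The formal birthday: the height of the game tree. -/
noncomputable def birthday : Game → ℕ
  | mk _ _ _ _ L R => max (⨆ i, (birthday (L i) + 1)) (⨆ j, (birthday (R j) + 1))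

theorem birthday_moveLeft (G : Game) (i : G.LeftMoves) :
    (G.moveLeft i).birthday < G.birthday := by
  cases G with
  | mk α β hα hβ L R =>
    have h : birthday (L i) + 1 ≤ ⨆ i, (birthday (L i) + 1) :=
      le_ciSup (f := fun i => birthday (L i) + 1) (Set.finite_range _).bddAbove i
    exact lt_of_lt_of_le (Nat.lt_of_succ_le h) (le_max_left _ _)

theorem birthday_moveRight (G : Game) (j : G.RightMoves) :
    (G.moveRight j).birthday < G.birthday := by
  cases G with
  | mk α β hα hβ L R =>
    have h : birthday (R j) + 1 ≤ ⨆ j, (birthday (R j) + 1) :=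
      le_ciSup (f := fun j => birthday (R j) + 1) (Set.finite_range _).bddAbove j
    exact lt_of_lt_of_le (Nat.lt_of_succ_le h) (le_max_right _ _)

/-- The order of games: `G ≤ H` iff no `G^L` satisfies `H ≤ G^L` and no `H^R` satisfies
`H^R ≤ G`. -/
protected def le (G H : Game) : Prop :=
  (∀ i : G.LeftMoves, ¬ Game.le H (G.moveLeft i)) ∧
    (∀ j : H.RightMoves, ¬ Game.le (H.moveRight j) G)
termination_by G.birthday + H.birthday
decreasing_by
  · have := birthday_moveLeft G i
    omega
  · have := birthday_moveRight H j
    omega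

instance : LE Game := ⟨Game.le⟩

theorem le_def (G H : Game) :
    G ≤ H ↔ (∀ i : G.LeftMoves, ¬ H ≤ G.moveLeft i) ∧
      (∀ j : H.RightMoves, ¬ H.moveRight j ≤ G) := by
  change Game.le G H ↔ _
  rw [Game.le]
  rfl

/-- Two games are equal (that is, they have the same game value) if `G ≤ H` and `H ≤ G`. -/
instance : HasEquiv Game := ⟨fun G H => G ≤ H ∧ H ≤ G⟩

/-- The zero game, without any options. -/
instance : Zero Game :=
  ⟨mk Empty Empty inferInstance inferInstance Empty.elim Empty.elim⟩

/-- The negative of a game: `-G = { -G^R | -G^L }`. -/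
protected def neg : Game → Game
  | mk α β hα hβ L R => mk β α hβ hα (fun j => Game.neg (R j)) (fun i => Game.neg (L i))

instance : Neg Game := ⟨Game.neg⟩

/-- The inner recursion of `Game.add`: here `fL i` stands for `H ↦ G^L + H`, and `fR j`
for `H ↦ G^R + H`. -/
def addAux {α β : Type} (hα : Finite α) (hβ : Finite β)
    (fL : α → Game → Game) (fR : β → Game → Game) : Game → Game
  | mk γ δ hγ hδ L R =>
    mk (α ⊕ γ) (β ⊕ δ) inferInstance inferInstance
      (Sum.elim (fun i => fL i (mk γ δ hγ hδ L R)) (fun i => addAux hα hβ fL fR (L i)))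
      (Sum.elim (fun j => fR j (mk γ δ hγ hδ L R)) (fun j => addAux hα hβ fL fR (R j)))

/-- The disjunctive sum `G + H = { G^L + H, G + H^L | G^R + H, G + H^R }`. -/
protected def add : Game → Game → Game
  | mk _ _ hα hβ L R => addAux hα hβ (fun i => Game.add (L i)) (fun j => Game.add (R j))

instance : Add Game := ⟨Game.add⟩

theorem mk_add_mk {α β γ δ : Type} (hα : Finite α) (hβ : Finite β) (hγ : Finite γ)
    (hδ : Finite δ) (L : α → Game) (R : β → Game) (L' : γ → Game) (R' : δ → Game) :
    mk α β hα hβ L R + mk γ δ hγ hδ L' R' =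
      mk (α ⊕ γ) (β ⊕ δ) inferInstance inferInstance
        (Sum.elim (fun i => L i + mk γ δ hγ hδ L' R') (fun i => mk α β hα hβ L R + L' i))
        (Sum.elim (fun j => R j + mk γ δ hγ hδ L' R') (fun j => mk α β hα hβ L R + R' j)) :=
  rfl

instance : Sub Game := ⟨fun G H => G + -H⟩

/-- `nG = G + ⋯ + G` (`n` summands). -/
def multiple : ℕ → Game → Game
  | 0, _ => 0
  | n + 1, G => multiple n G + G

/-! ### Numbers -/

/-- The canonical form of a natural number: `0 = { | }` and `n + 1 = { n | }`. -/
def ofNat : ℕ → Game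
  | 0 => 0
  | n + 1 => mk Unit Empty inferInstance inferInstance (fun _ => ofNat n) Empty.elim

/-- The canonical form of an integer: that of `n` if it is non-negative, and the negative of the
canonical form of `-n` otherwise. -/
def ofInt : ℤ → Game
  | Int.ofNat n => ofNat n
  | Int.negSucc n => -ofNat (n + 1)

/-- The canonical form of `k / 2 ^ m`: for odd `k` and `m ≥ 1` it is
`{ (k - 1) / 2 ^ m | (k + 1) / 2 ^ m }`. For even `k` the fraction is cancelled first. -/
def ofFraction : ℤ → ℕ → Game
  | k, 0 => ofInt k
  | k, m + 1 =>
    if k % 2 = 0 then ofFraction (k / 2) m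
    else
      mk Unit Unit inferInstance inferInstance
        (fun _ => ofFraction ((k - 1) / 2) m) (fun _ => ofFraction ((k + 1) / 2) m)

/-- The canonical form of a dyadic rational (its reduced denominator is a power of `2`). -/
def ofDyadic (x : Dy) : Game :=
  ofFraction (x : ℚ).num (Nat.log 2 (x : ℚ).den)

/-! ### Stops -/

/-- The pair of the Left stop and the Right stop: both are `x` if `G` is equal to the number `x`,
and otherwise `L(G) = max R(G^L)` and `R(G) = min L(G^R)`. -/
noncomputable def stops : Game → Dy × Dy
  | mk α β hα hβ L R =>
    open Classical in
    if h : ∃ x : Dy, mk α β hα hβ L R ≈ ofDyadic x then (h.choose, h.choose)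
    else (maxOf fun i => (stops (L i)).2, minOf fun j => (stops (R j)).1)

/-- The Left stop `L(G)`. -/
noncomputable def leftStop (G : Game) : Dy := G.stops.1

/-- The Right stop `R(G)`. -/
noncomputable def rightStop (G : Game) : Dy := G.stops.2

/-! ### Temperature and cooling -/

/-- The data attached to a game `G`: the trajectories `t ↦ λ_t(G)` and `t ↦ ρ_t(G)`, the cooled
games `t ↦ G_t`, and the temperature `t(G)`, where `⊥` stands for `-∞`. -/
structure Thermo : Type 1 where
  lam : Dy → Dy
  rho : Dy → Dy
  cooled : Dy → Game
  temp : WithBot Dy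

/-- The simultaneous recursive definition of `λ_t(G)`, `ρ_t(G)`, `G_t` and `t(G)`.
If `G` is equal to an integer `n`, then `λ_t(G) = ρ_t(G) = n`, `G_t = n` and `t(G) = -∞`.
Otherwise `lamT`, `rhoT`, `coolT` are the functions with a tilde, `t(G) = s` is the least `t` with
`lamT t = rhoT t`, and beyond `s` everything is frozen at the value `lamT s = rhoT s`.
(Such a least `t` always exists; the last branch is only there to make the definition total.) -/
noncomputable def thermo : Game → Thermo
  | mk α β hα hβ L R =>
    open Classical in
    if h : ∃ n : ℤ, mk α β hα hβ L R ≈ ofInt n then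
      { lam := fun _ => (h.choose : Dy)
        rho := fun _ => (h.choose : Dy)
        cooled := fun _ => ofInt h.choose
        temp := ⊥ }
    else
      let lamT : Dy → Dy := fun t => maxOf fun i => (thermo (L i)).rho t - t
      let rhoT : Dy → Dy := fun t => minOf fun j => (thermo (R j)).lam t + t
      let coolT : Dy → Game := fun t =>
        mk α β hα hβ (fun i => (thermo (L i)).cooled t - ofDyadic t)
          (fun j => (thermo (R j)).cooled t + ofDyadic t)
      if hs : ∃ s : Dy, IsLeast {t : Dy | lamT t = rhoT t} s then
        { lam := fun t => if t ≤ hs.choose then lamT t else lamT hs.choose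
          rho := fun t => if t ≤ hs.choose then rhoT t else lamT hs.choose
          cooled := fun t => if t ≤ hs.choose then coolT t else ofDyadic (lamT hs.choose)
          temp := (hs.choose : WithBot Dy) }
      else
        { lam := lamT, rho := rhoT, cooled := coolT, temp := ⊥ }

/-- The temperature `t(G)`. -/
noncomputable def temp (G : Game) : WithBot Dy := G.thermo.temp

/-- The game `G_t`, that is, `G` cooled by `t`. -/
noncomputable def cool (G : Game) (t : Dy) : Game := G.thermo.cooled t

end Game

end CGT

namespace CGT

namespace Game

/-! The core is a strategy argument for sums of games, `sum_bounds`. For `t ≥ 0` two claims about a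
sum plus a number `y` are proved together by induction on the total birthday. (A) If the left
trajectories `λ_t` of the components and `y` add up to at most `0`, then the sum is at most `t + 1`.
(B) If one component contributes `ρ_t` in place of `λ_t`, then the sum is not at least `1`. A Left
move gains at most `t`, since `ρ_t(G^L) ≤ λ_t(G) + t`; so (A) follows from (B). For (B), Right moves
in a component of temperature at least `t`, to an option with `λ_t(G^R) + t = ρ_t(G)`. If there is
none, `t` is lowered to the highest temperature, which changes no `λ_t`; if all temperatures are
negative, all components are numbers. For `n` copies of `G` and of `-G` this gives `|nG - nG_t| ≤ t
+ 1`. Such bounds confine the stops of `nG` (`stops_mem_Icc`), and the limits follow by squeezing.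

Two facts support this. The temperature exists among the dyadic rationals (`isRegular`):
trajectories are linear on the cells of every sufficiently fine dyadic grid, with slopes `0` and
`±1`, so they meet at a dyadic point. Games of negative temperature are numbers
(`val_eq_num_of_temp_neg`): at `t = -1 / 2 ^ m` the trajectories are the multiples of `1 / 2 ^ m`
closest to `G` from below and above (`isFloor_and_isCeil`), and these enclose `G` and coincide from
the temperature on. -/

theorem induction {P : Game → Prop}
    (h : ∀ G : Game, (∀ i, P (G.moveLeft i)) → (∀ j, P (G.moveRight j)) → P G) (G : Game) :
    P G := by
  induction G with
  | mk α β hα hβ L R ihL ihR => exact h _ ihL ihR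

instance (G : Game) : Finite G.LeftMoves := by
  cases G; assumption

instance (G : Game) : Finite G.RightMoves := by
  cases G; assumption

theorem not_le_iff (G H : Game) :
    ¬ H ≤ G ↔ (∃ i, G ≤ H.moveLeft i) ∨ (∃ j, G.moveRight j ≤ H) := by
  rw [le_def]
  by_cases h : ∃ i, G ≤ H.moveLeft i
  · simp only [h, true_or, iff_true]
    obtain ⟨i, hi⟩ := h
    exact fun h' => h'.1 i hi
  · push Not at h
    simp only [not_and, not_forall, not_not]
    constructor
    · exact fun h' => Or.inr (h' h)
    · rintro (⟨i, hi⟩ | h') _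
      · exact absurd hi (h i)
      · exact h'

/-! ### Options of sums and negatives -/

/-- The moves of a sum form a disjoint union only once both games are destructed. Quantifying over a
predicate `P` on options spares any transport of indices. -/
theorem exists_moveLeft_add {G H : Game} {P : Game → Prop} :
    (∃ i, P ((G + H).moveLeft i)) ↔
      (∃ i, P (G.moveLeft i + H)) ∨ (∃ i, P (G + H.moveLeft i)) := by
  cases G; cases H
  exact Sum.exists

theorem exists_moveRight_add {G H : Game} {P : Game → Prop} :
    (∃ i, P ((G + H).moveRight i)) ↔
      (∃ i, P (G.moveRight i + H)) ∨ (∃ i, P (G + H.moveRight i)) := by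
  cases G; cases H
  exact Sum.exists

theorem forall_moveLeft_add {G H : Game} {P : Game → Prop} :
    (∀ i, P ((G + H).moveLeft i)) ↔
      (∀ i, P (G.moveLeft i + H)) ∧ (∀ i, P (G + H.moveLeft i)) := by
  cases G; cases H
  exact Sum.forall

theorem forall_moveRight_add {G H : Game} {P : Game → Prop} :
    (∀ i, P ((G + H).moveRight i)) ↔
      (∀ i, P (G.moveRight i + H)) ∧ (∀ i, P (G + H.moveRight i)) := by
  cases G; cases H
  exact Sum.forall

theorem exists_moveLeft_neg {G : Game} {P : Game → Prop} :
    (∃ i, P ((-G).moveLeft i)) ↔ ∃ j, P (-G.moveRight j) := by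
  cases G; exact Iff.rfl

theorem exists_moveRight_neg {G : Game} {P : Game → Prop} :
    (∃ i, P ((-G).moveRight i)) ↔ ∃ j, P (-G.moveLeft j) := by
  cases G; exact Iff.rfl

theorem forall_moveLeft_neg {G : Game} {P : Game → Prop} :
    (∀ i, P ((-G).moveLeft i)) ↔ ∀ j, P (-G.moveRight j) := by
  cases G; exact Iff.rfl

theorem forall_moveRight_neg {G : Game} {P : Game → Prop} :
    (∀ i, P ((-G).moveRight i)) ↔ ∀ j, P (-G.moveLeft j) := by
  cases G; exact Iff.rfl

instance : IsEmpty (LeftMoves 0) := inferInstanceAs (IsEmpty Empty)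
instance : IsEmpty (RightMoves 0) := inferInstanceAs (IsEmpty Empty)

protected theorem neg_neg (G : Game) : - -G = G := by
  induction G with
  | mk α β hα hβ L R ihL ihR =>
    change mk α β hα hβ (fun i => - -L i) (fun j => - -R j) = _
    simp only [ihL, ihR]

/-! ### The order -/

protected theorem le_refl (G : Game) : G ≤ G := by
  induction G using Game.induction with
  | h G ihL ihR =>
    rw [le_def]
    exact ⟨fun i => (not_le_iff _ _).2 (Or.inl ⟨i, ihL i⟩),
      fun j => (not_le_iff _ _).2 (Or.inr ⟨j, ihR j⟩)⟩

theorem not_le_moveLeft (G : Game) (i : G.LeftMoves) : ¬ G ≤ G.moveLeft i :=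
  ((le_def G G).1 (Game.le_refl G)).1 i

theorem not_moveRight_le (G : Game) (j : G.RightMoves) : ¬ G.moveRight j ≤ G :=
  ((le_def G G).1 (Game.le_refl G)).2 j

protected theorem le_trans {G H K : Game} (h₁ : G ≤ H) (h₂ : H ≤ K) : G ≤ K := by
  suffices ∀ n : ℕ, ∀ G H K : Game, G.birthday + H.birthday + K.birthday ≤ n →
      G ≤ H → H ≤ K → G ≤ K from this _ G H K le_rfl h₁ h₂
  intro n
  induction n using Nat.strong_induction_on with
  | h n ih =>
    intro G H K hn h₁ h₂
    rw [le_def]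
    constructor
    · intro i hi
      -- The triple is rotated: `H ≤ K ≤ G^L` has smaller total birthday and would give `H ≤ G^L`,
      -- against `G ≤ H`.
      refine ((le_def G H).1 h₁).1 i
        (ih _ ?_ H K (G.moveLeft i) le_rfl h₂ hi)
      have := birthday_moveLeft G i
      omega
    · intro j hj
      refine ((le_def H K).1 h₂).2 j
        (ih _ ?_ (K.moveRight j) G H le_rfl hj h₁)
      have := birthday_moveRight K j
      omega

protected theorem neg_le_neg {G H : Game} (h : G ≤ H) : -H ≤ -G := by
  suffices ∀ n : ℕ, ∀ G H : Game, G.birthday + H.birthday ≤ n → ((G ≤ H → -H ≤ -G) ∧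
      (-H ≤ -G → G ≤ H)) from (this _ G H le_rfl).1 h
  intro n
  induction n using Nat.strong_induction_on with
  | h n ih =>
    intro G H hn
    have hG (i) : H ≤ G.moveLeft i ↔ -G.moveLeft i ≤ -H :=
      have := birthday_moveLeft G i
      iff_def.2 (ih _ (by omega) _ _ le_rfl)
    have hH (j) : H.moveRight j ≤ G ↔ -G ≤ -H.moveRight j :=
      have := birthday_moveRight H j
      iff_def.2 (ih _ (by omega) _ _ le_rfl)
    rw [← iff_def, le_def, le_def (-H), forall_moveLeft_neg (P := fun K => ¬ -G ≤ K),
      forall_moveRight_neg (P := fun K => ¬ K ≤ -H), and_comm]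
    simp only [hG, hH]

/-! ### The group laws up to equality -/

protected theorem add_comm_le (G H : Game) : G + H ≤ H + G := by
  induction G using Game.induction generalizing H with
  | h G ihL ihR =>
    induction H using Game.induction with
    | h H ihL' ihR' =>
      rw [le_def, forall_moveLeft_add (P := fun K => ¬ H + G ≤ K),
        forall_moveRight_add (P := fun K => ¬ K ≤ G + H)]
      simp only [not_le_iff]
      refine ⟨⟨fun i => Or.inl ?_, fun i => Or.inl ?_⟩, fun i => Or.inr ?_, fun i => Or.inr ?_⟩
      · exact (exists_moveLeft_add (P := fun K => _ ≤ K)).2 (Or.inr ⟨i, ihL i H⟩)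
      · exact (exists_moveLeft_add (P := fun K => _ ≤ K)).2 (Or.inl ⟨i, ihL' i⟩)
      · exact (exists_moveRight_add (P := fun K => K ≤ _)).2 (Or.inr ⟨i, ihR' i⟩)
      · exact (exists_moveRight_add (P := fun K => K ≤ _)).2 (Or.inl ⟨i, ihR i H⟩)

protected theorem add_zero (G : Game) : G + 0 ≤ G ∧ G ≤ G + 0 := by
  induction G using Game.induction with
  | h G ihL ihR =>
    rw [le_def, le_def G, forall_moveLeft_add (P := fun K => ¬ G ≤ K),
      forall_moveRight_add (P := fun K => ¬ K ≤ G)]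
    refine ⟨⟨⟨fun i => ?_, isEmptyElim⟩, fun j => ?_⟩, fun i => ?_, fun j => ?_, isEmptyElim⟩
    · exact (not_le_iff _ _).2 (Or.inl ⟨i, (ihL i).1⟩)
    · exact (not_le_iff _ _).2 (Or.inr
        ((exists_moveRight_add (P := fun K => K ≤ _)).2 (Or.inl ⟨j, (ihR j).1⟩)))
    · exact (not_le_iff _ _).2 (Or.inl
        ((exists_moveLeft_add (P := fun K => _ ≤ K)).2 (Or.inl ⟨i, (ihL i).2⟩)))
    · exact (not_le_iff _ _).2 (Or.inr ⟨j, (ihR j).2⟩)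

protected theorem add_assoc (G H K : Game) :
    G + H + K ≤ G + (H + K) ∧ G + (H + K) ≤ G + H + K := by
  induction G using Game.induction generalizing H K with
  | h G ihL ihR =>
    induction H using Game.induction generalizing K with
    | h H ihL' ihR' =>
      induction K using Game.induction with
      | h K ihL'' ihR'' =>
        have l₁ (P : Game → Prop) : (∀ i, P ((G + H + K).moveLeft i)) ↔
            ((∀ i, P (G.moveLeft i + H + K)) ∧ (∀ i, P (G + H.moveLeft i + K))) ∧
              (∀ i, P (G + H + K.moveLeft i)) := by
          rw [forall_moveLeft_add, forall_moveLeft_add (P := fun X => P (X + K))]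
        have l₂ (P : Game → Prop) : (∀ i, P ((G + (H + K)).moveLeft i)) ↔
            (∀ i, P (G.moveLeft i + (H + K))) ∧ (∀ i, P (G + (H.moveLeft i + K))) ∧
              (∀ i, P (G + (H + K.moveLeft i))) := by
          rw [forall_moveLeft_add, forall_moveLeft_add (P := fun X => P (G + X))]
        have r₁ (P : Game → Prop) : (∀ i, P ((G + H + K).moveRight i)) ↔
            ((∀ i, P (G.moveRight i + H + K)) ∧ (∀ i, P (G + H.moveRight i + K))) ∧
              (∀ i, P (G + H + K.moveRight i)) := by
          rw [forall_moveRight_add, forall_moveRight_add (P := fun X => P (X + K))]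
        have r₂ (P : Game → Prop) : (∀ i, P ((G + (H + K)).moveRight i)) ↔
            (∀ i, P (G.moveRight i + (H + K))) ∧ (∀ i, P (G + (H.moveRight i + K))) ∧
              (∀ i, P (G + (H + K.moveRight i))) := by
          rw [forall_moveRight_add, forall_moveRight_add (P := fun X => P (G + X))]
        have L₁ := (l₁ fun X => ¬ G + H + K ≤ X).1 (not_le_moveLeft _)
        have L₂ := (l₂ fun X => ¬ G + (H + K) ≤ X).1 (not_le_moveLeft _)
        have R₁ := (r₁ fun X => ¬ X ≤ G + H + K).1 (not_moveRight_le _)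
        have R₂ := (r₂ fun X => ¬ X ≤ G + (H + K)).1 (not_moveRight_le _)
        constructor
        · rw [le_def, l₁ fun X => ¬ G + (H + K) ≤ X, r₂ fun X => ¬ X ≤ G + H + K]
          exact ⟨⟨⟨fun i h => L₂.1 i (Game.le_trans h (ihL i _ _).1),
            fun i h => L₂.2.1 i (Game.le_trans h (ihL' i _).1)⟩,
            fun i h => L₂.2.2 i (Game.le_trans h (ihL'' i).1)⟩,
            fun i h => R₁.1.1 i (Game.le_trans (ihR i _ _).1 h),
            fun i h => R₁.1.2 i (Game.le_trans (ihR' i _).1 h),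
            fun i h => R₁.2 i (Game.le_trans (ihR'' i).1 h)⟩
        · rw [le_def, l₂ fun X => ¬ G + H + K ≤ X, r₁ fun X => ¬ X ≤ G + (H + K)]
          exact ⟨⟨fun i h => L₁.1.1 i (Game.le_trans h (ihL i _ _).2),
            fun i h => L₁.1.2 i (Game.le_trans h (ihL' i _).2),
            fun i h => L₁.2 i (Game.le_trans h (ihL'' i).2)⟩,
            ⟨fun i h => R₂.1 i (Game.le_trans (ihR i _ _).2 h),
            fun i h => R₂.2.1 i (Game.le_trans (ihR' i _).2 h)⟩,
            fun i h => R₂.2.2 i (Game.le_trans (ihR'' i).2 h)⟩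

/-- The order is defined through negated comparisons, so the induction also carries the claim that
`¬ H ≤ G` survives adding `K`. -/
protected theorem add_le_add_right {G H : Game} (h : G ≤ H) (K : Game) : G + K ≤ H + K := by
  suffices ∀ n : ℕ, ∀ G H K : Game, G.birthday + H.birthday + K.birthday ≤ n →
      (G ≤ H → G + K ≤ H + K) ∧ (¬ H ≤ G → ¬ H + K ≤ G + K) from (this _ G H K le_rfl).1 h
  intro n
  induction n using Nat.strong_induction_on with
  | h n ih =>
    intro G H K hn
    constructor
    · intro h
      rw [le_def, forall_moveLeft_add (P := fun X => ¬ _ ≤ X),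
        forall_moveRight_add (P := fun X => ¬ X ≤ _)]
      refine ⟨⟨fun i => ?_, fun i => ?_⟩, fun j => ?_, fun j => ?_⟩
      · have := birthday_moveLeft G i
        exact (ih _ (by omega) (G.moveLeft i) H K le_rfl).2 (((le_def _ _).1 h).1 i)
      · have := birthday_moveLeft K i
        exact (not_le_iff _ _).2 (Or.inl ((exists_moveLeft_add (P := fun X => _ ≤ X)).2
          (Or.inr ⟨i, (ih _ (by omega) G H (K.moveLeft i) le_rfl).1 h⟩)))
      · have := birthday_moveRight H j
        exact (ih _ (by omega) G (H.moveRight j) K le_rfl).2 (((le_def _ _).1 h).2 j)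
      · have := birthday_moveRight K j
        exact (not_le_iff _ _).2 (Or.inr ((exists_moveRight_add (P := fun X => X ≤ _)).2
          (Or.inr ⟨j, (ih _ (by omega) G H (K.moveRight j) le_rfl).1 h⟩)))
    · intro h
      rw [not_le_iff] at h
      rw [not_le_iff, exists_moveLeft_add (P := fun X => _ ≤ X),
        exists_moveRight_add (P := fun X => X ≤ _)]
      rcases h with ⟨i, hi⟩ | ⟨j, hj⟩
      · have := birthday_moveLeft H i
        exact Or.inl (Or.inl ⟨i, (ih _ (by omega) G (H.moveLeft i) K le_rfl).1 hi⟩)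
      · have := birthday_moveRight G j
        exact Or.inr (Or.inl ⟨j, (ih _ (by omega) (G.moveRight j) H K le_rfl).1 hj⟩)

/-- Right answers each Left move by the mirror move in the other summand. -/
protected theorem add_neg_le (G : Game) : G + -G ≤ 0 := by
  induction G using Game.induction with
  | h G ihL ihR =>
    rw [le_def, forall_moveLeft_add (P := fun X => ¬ _ ≤ X)]
    refine ⟨⟨fun i => ?_, ?_⟩, isEmptyElim⟩
    · rw [not_le_iff, exists_moveRight_add (P := fun X => X ≤ _),
        exists_moveRight_neg (P := fun X => _ + X ≤ _)]
      exact Or.inr (Or.inr ⟨i, ihL i⟩)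
    · rw [forall_moveLeft_neg (P := fun X => ¬ 0 ≤ G + X)]
      intro j
      rw [not_le_iff, exists_moveRight_add (P := fun X => X ≤ _)]
      exact Or.inr (Or.inl ⟨j, ihR j⟩)

protected theorem neg_add_eq (G H : Game) : -(G + H) = -G + -H := by
  induction G generalizing H with
  | mk α β hα hβ L R ihL ihR =>
    induction H with
    | mk γ δ hγ hδ L' R' ihL' ihR' =>
      change mk (β ⊕ δ) (α ⊕ γ) _ _ _ _ = mk (β ⊕ δ) (α ⊕ γ) _ _ _ _
      congr 1
      · funext x
        rcases x with x | x
        · exact ihR x _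
        · exact ihR' x
      · funext x
        rcases x with x | x
        · exact ihL x _
        · exact ihL' x

protected theorem neg_zero_eq : -(0 : Game) = 0 := by
  change mk Empty Empty _ _ _ _ = mk Empty Empty _ _ _ _
  congr 1 <;> exact funext (fun x => x.elim)

protected theorem zero_le_add_neg (G : Game) : 0 ≤ G + -G := by
  have h := Game.neg_le_neg (Game.add_neg_le (-G))
  rwa [Game.neg_zero_eq, Game.neg_add_eq, Game.neg_neg] at h

/-! ### The ordered group of game values -/

instance setoid : Setoid Game where
  r G H := G ≤ H ∧ H ≤ G
  iseqv := ⟨fun G => ⟨Game.le_refl G, Game.le_refl G⟩, fun h => ⟨h.2, h.1⟩,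
    fun h h' => ⟨Game.le_trans h.1 h'.1, Game.le_trans h'.2 h.2⟩⟩

end Game

/-- Game values: games up to equality. -/
def Val : Type 1 := Quotient Game.setoid

namespace Game

/-- The value of a game. -/
def val (G : Game) : Val := Quotient.mk _ G

end Game

namespace Val
open Game

instance : LE Val where
  le := Quotient.lift₂ (fun G H => G ≤ H) fun _ _ _ _ h h' => propext
    ⟨fun k => Game.le_trans h.2 (Game.le_trans k h'.1),
      fun k => Game.le_trans h.1 (Game.le_trans k h'.2)⟩

instance : PartialOrder Val where
  le_refl := by rintro ⟨G⟩; exact Game.le_refl G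
  le_trans := by rintro ⟨G⟩ ⟨H⟩ ⟨K⟩ h h'; exact Game.le_trans (G := G) (H := H) (K := K) h h'
  le_antisymm := by rintro ⟨G⟩ ⟨H⟩ h h'; exact Quotient.sound ⟨h, h'⟩

theorem add_mono {G G' H H' : Game} (h : G ≤ G') (h' : H ≤ H') : G + H ≤ G' + H' :=
  Game.le_trans (Game.add_le_add_right h H) (Game.le_trans (Game.add_comm_le _ _)
    (Game.le_trans (Game.add_le_add_right h' _) (Game.add_comm_le _ _)))

instance : Zero Val := ⟨val 0⟩

instance : Add Val where
  add := Quotient.map₂ (· + ·) fun _ _ h _ _ h' => ⟨add_mono h.1 h'.1, add_mono h.2 h'.2⟩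

instance : Neg Val where
  neg := Quotient.map (- ·) fun _ _ h => ⟨Game.neg_le_neg h.2, Game.neg_le_neg h.1⟩

instance : AddCommGroup Val where
  add_assoc := by rintro ⟨G⟩ ⟨H⟩ ⟨K⟩; exact Quotient.sound (Game.add_assoc G H K)
  zero_add := by
    rintro ⟨G⟩
    exact Quotient.sound ⟨Game.le_trans (Game.add_comm_le _ _) (Game.add_zero G).1,
      Game.le_trans (Game.add_zero G).2 (Game.add_comm_le _ _)⟩
  add_zero := by rintro ⟨G⟩; exact Quotient.sound (Game.add_zero G)
  nsmul := nsmulRec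
  zsmul := zsmulRec
  neg_add_cancel := by
    rintro ⟨G⟩
    exact Quotient.sound ⟨Game.le_trans (Game.add_comm_le _ _) (Game.add_neg_le G),
      Game.le_trans (Game.zero_le_add_neg G) (Game.add_comm_le _ _)⟩
  add_comm := by
    rintro ⟨G⟩ ⟨H⟩; exact Quotient.sound ⟨Game.add_comm_le G H, Game.add_comm_le H G⟩

instance : IsOrderedAddMonoid Val where
  add_le_add_left := by
    rintro ⟨G⟩ ⟨H⟩ h ⟨K⟩; exact Game.add_le_add_right (G := G) (H := H) h K

end Val

namespace Game

theorem val_le_val {G H : Game} : G.val ≤ H.val ↔ G ≤ H := Iff.rfl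

theorem val_eq_val {G H : Game} : G.val = H.val ↔ G ≈ H :=
  ⟨fun h => Quotient.exact h, fun h => Quotient.sound h⟩

@[simp] theorem val_zero : (0 : Game).val = 0 := rfl
@[simp] theorem val_add (G H : Game) : (G + H).val = G.val + H.val := rfl
@[simp] theorem val_neg (G : Game) : (-G).val = -G.val := rfl
@[simp] theorem val_sub (G H : Game) : (G - H).val = G.val - H.val := by
  rw [sub_eq_add_neg]; rfl

@[simp] theorem val_multiple (n : ℕ) (G : Game) : (multiple n G).val = n • G.val := by
  induction n with
  | zero => rw [zero_nsmul]; rfl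
  | succ n ih => rw [succ_nsmul, ← ih]; rfl

theorem val_le_iff (G H : Game) : G.val ≤ H.val ↔
    (∀ i, ¬ H.val ≤ (G.moveLeft i).val) ∧ (∀ j, ¬ (H.moveRight j).val ≤ G.val) :=
  le_def G H

theorem not_val_le_moveLeft (G : Game) (i : G.LeftMoves) : ¬ G.val ≤ (G.moveLeft i).val :=
  not_le_moveLeft G i

theorem not_val_moveRight_le (G : Game) (j : G.RightMoves) : ¬ (G.moveRight j).val ≤ G.val :=
  not_moveRight_le G j

end Game

/-! ### The grid of multiples of `1 / 2 ^ m` -/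

/-- The dyadic rational `1 / 2 ^ m`. -/
def mesh (m : ℕ) : Dy := ⟨1 / 2 ^ m, 1, m, by simp⟩

theorem coe_mesh (m : ℕ) : ((mesh m : Dy) : ℚ) = 1 / 2 ^ m := rfl

theorem mesh_pos (m : ℕ) : 0 < mesh m := by
  rw [← Subtype.coe_lt_coe, coe_mesh]; simp

theorem mesh_zero : mesh 0 = 1 := by
  ext; simp [coe_mesh]

theorem mesh_succ (m : ℕ) : mesh m = 2 * mesh (m + 1) := by
  ext
  push_cast
  rw [coe_mesh, coe_mesh, pow_succ]
  field_simp
  rfl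

/-- The dyadic rational `k / 2 ^ m`. -/
def frac (k : ℤ) (m : ℕ) : Dy := k * mesh m

theorem coe_frac (k : ℤ) (m : ℕ) : ((frac k m : Dy) : ℚ) = k / 2 ^ m := by
  rw [frac]; push_cast; rw [coe_mesh]; ring

theorem frac_two_mul (k : ℤ) (m : ℕ) : frac (2 * k) (m + 1) = frac k m := by
  rw [frac, frac, mesh_succ m]; push_cast; ring

theorem frac_zero (k : ℤ) : frac k 0 = k := by rw [frac, mesh_zero, mul_one]

theorem frac_lt_frac {k l : ℤ} {m : ℕ} : frac k m < frac l m ↔ k < l := by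
  rw [frac, frac, mul_lt_mul_iff_left₀ (mesh_pos m), Int.cast_lt]

theorem frac_le_frac {k l : ℤ} {m : ℕ} : frac k m ≤ frac l m ↔ k ≤ l := by
  rw [frac, frac, mul_le_mul_iff_left₀ (mesh_pos m), Int.cast_le]

theorem frac_add (k l : ℤ) (m : ℕ) : frac (k + l) m = frac k m + frac l m := by
  simp only [frac]; push_cast; ring

theorem frac_neg (k : ℤ) (m : ℕ) : frac (-k) m = -frac k m := by
  simp only [frac]; push_cast; ring

theorem frac_one (m : ℕ) : frac 1 m = mesh m := by simp [frac]

theorem exists_frac_add (k : ℤ) (m n : ℕ) : ∃ l, frac k m = frac l (m + n) := by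
  induction n with
  | zero => exact ⟨k, rfl⟩
  | succ n ih =>
    obtain ⟨l, hl⟩ := ih
    exact ⟨2 * l, by rw [hl, ← frac_two_mul]; rfl⟩

theorem exists_frac_of_le (k : ℤ) {m n : ℕ} (h : m ≤ n) : ∃ l, frac k m = frac l n := by
  obtain ⟨d, rfl⟩ := Nat.exists_eq_add_of_le h
  exact exists_frac_add k m d

theorem exists_eq_frac (x : Dy) : ∃ k m, x = frac k m := by
  obtain ⟨x, k, m, rfl⟩ := x
  exact ⟨k, m, by ext; rw [coe_frac]⟩

/-- A fraction is either an integer or in lowest terms for some positive exponent. -/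
theorem frac_cases (k : ℤ) (m : ℕ) :
    (∃ n, frac k m = frac n 0) ∨ ∃ l n, n + 1 ≤ m ∧ frac k m = frac (2 * l + 1) (n + 1) := by
  induction m generalizing k with
  | zero => exact Or.inl ⟨k, rfl⟩
  | succ m ih =>
    rcases Int.even_or_odd' k with ⟨l, rfl | rfl⟩
    · rw [frac_two_mul]
      rcases ih l with h | ⟨l', n, hn, h⟩
      · exact Or.inl h
      · exact Or.inr ⟨l', n, by omega, h⟩
    · exact Or.inr ⟨l, m, le_rfl, rfl⟩

/-! ### Canonical forms of dyadic rationals as an ordered group; number avoidance -/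

namespace Game

theorem ofDyadic_frac (k : ℤ) (m : ℕ) : ofDyadic (frac k m) = ofFraction k m := by
  induction m generalizing k with
  | zero => simp [ofDyadic, coe_frac, ofFraction]
  | succ m ih =>
    rcases Int.even_or_odd' k with ⟨l, rfl | rfl⟩
    · rw [frac_two_mul, ih, ofFraction]
      simp
    · have h : IsCoprime (2 * l + 1) (2 ^ (m + 1) : ℤ) := by
        apply IsCoprime.pow_right
        exact ⟨1, -l, by ring⟩
      have h1 : ((frac (2 * l + 1) (m + 1) : Dy) : ℚ) =
          ((2 * l + 1 : ℤ) : ℚ) / ((2 ^ (m + 1) : ℤ) : ℚ) := by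
        rw [coe_frac]; push_cast; rfl
      have h2 : Nat.Coprime (2 * l + 1).natAbs (2 ^ (m + 1) : ℤ).natAbs :=
        Int.isCoprime_iff_gcd_eq_one.1 h
      rw [ofDyadic, h1, Rat.num_div_eq_of_coprime (by positivity) h2]
      congr 1
      have h3 := Rat.den_div_eq_of_coprime (by positivity) h2
      have h4 : (((2 * l + 1 : ℤ) : ℚ) / ((2 ^ (m + 1) : ℤ) : ℚ)).den = 2 ^ (m + 1) := by
        exact_mod_cast h3
      rw [h4, Nat.log_pow (by norm_num)]

theorem ofDyadic_intCast (n : ℤ) : ofDyadic n = ofInt n := by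
  rw [← frac_zero, ofDyadic_frac, ofFraction]

theorem ofDyadic_odd (l : ℤ) (m : ℕ) : ofDyadic (frac (2 * l + 1) (m + 1)) =
    mk Unit Unit inferInstance inferInstance
      (fun _ => ofDyadic (frac l m)) (fun _ => ofDyadic (frac (l + 1) m)) := by
  rw [ofDyadic_frac, ofFraction, if_neg (by omega), ofDyadic_frac, ofDyadic_frac]
  congr 2
  · funext _; congr 1; omega
  · funext _; congr 1; omega

theorem ofDyadic_natCast_succ (n : ℕ) : ofDyadic ((n + 1 : ℕ) : ℤ) =
    mk Unit Empty inferInstance inferInstance (fun _ => ofDyadic ((n : ℕ) : ℤ)) Empty.elim := by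
  rw [ofDyadic_intCast, ofDyadic_intCast]
  rfl

theorem ofDyadic_zero : ofDyadic 0 = 0 := by
  have h := ofDyadic_intCast 0
  rw [Int.cast_zero] at h
  rw [h]; rfl

theorem ofInt_neg (n : ℤ) : ofInt (-n) = -ofInt n := by
  rcases n with (_ | n) | n
  · exact Game.neg_zero_eq.symm
  · rfl
  · exact (Game.neg_neg _).symm

theorem ofDyadic_neg (x : Dy) : ofDyadic (-x) = -ofDyadic x := by
  obtain ⟨k, m, rfl⟩ := exists_eq_frac x
  induction m generalizing k with
  | zero => rw [frac_zero, ← Int.cast_neg, ofDyadic_intCast, ofDyadic_intCast, ofInt_neg]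
  | succ m ih =>
    rcases Int.even_or_odd' k with ⟨l, rfl | rfl⟩
    · rw [frac_two_mul, ih]
    · rw [← frac_neg, show -(2 * l + 1) = 2 * (-l - 1) + 1 by ring, ofDyadic_odd, ofDyadic_odd,
        show -l - 1 + 1 = -l by ring, show -l - 1 = -(l + 1) by ring, frac_neg, frac_neg, ih, ih]
      rfl

/-- The Left option of the canonical form of a dyadic rational is the canonical form of a smaller
number in the same grid. -/
theorem moveLeft_ofDyadic (k : ℤ) (m : ℕ) (i : (ofDyadic (frac k m)).LeftMoves) :
    ∃ l, l < k ∧ (ofDyadic (frac k m)).moveLeft i = ofDyadic (frac l m) := by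
  rcases frac_cases k m with ⟨n, hn⟩ | ⟨l, n, hnm, hl⟩
  · have hn' : frac k m = n := by rw [hn, frac_zero]
    revert i
    rw [hn']
    rcases n with (_ | n) | n
    · intro i
      rw [show ((Int.ofNat 0 : ℤ) : Dy) = 0 by simp, ofDyadic_zero] at i
      exact isEmptyElim i
    · intro i
      obtain ⟨l, hl⟩ := exists_frac_of_le (n : ℤ) (Nat.zero_le m)
      refine ⟨l, ?_, ?_⟩
      · rw [← frac_lt_frac (m := m), ← hl, hn, frac_lt_frac]
        simp
      · rw [← hl, frac_zero]
        revert i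
        rw [show ((Int.ofNat (n + 1) : ℤ) : Dy) = ((n + 1 : ℕ) : ℤ) from rfl,
          ofDyadic_natCast_succ]
        exact fun _ => rfl
    · intro i
      rw [ofDyadic_intCast] at i
      exact (i : Empty).elim
  · obtain ⟨l', hl'⟩ := exists_frac_of_le l (show n ≤ m by omega)
    refine ⟨l', ?_, ?_⟩
    · rw [← frac_lt_frac (m := m), ← hl', hl, ← frac_two_mul, frac_lt_frac]
      omega
    · rw [← hl']
      revert i
      rw [hl, ofDyadic_odd]
      exact fun _ => rfl

theorem moveRight_ofDyadic (k : ℤ) (m : ℕ) (j : (ofDyadic (frac k m)).RightMoves) :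
    ∃ l, k < l ∧ (ofDyadic (frac k m)).moveRight j = ofDyadic (frac l m) := by
  have h := moveLeft_ofDyadic (-k) m
  rw [frac_neg, ofDyadic_neg, forall_moveLeft_neg
    (P := fun X => ∃ l, l < -k ∧ X = ofDyadic (frac l m))] at h
  obtain ⟨l, hl, h⟩ := h j
  refine ⟨-l, by omega, ?_⟩
  rw [← Game.neg_neg (moveRight _ j), h, frac_neg, ofDyadic_neg]

theorem exists_moveLeft_intCast {n : ℤ} (hn : 0 < n) :
    ∃ i, (ofDyadic (frac n 0)).moveLeft i = ofDyadic (frac (n - 1) 0) := by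
  obtain ⟨n, rfl⟩ := Int.eq_succ_of_zero_lt hn
  rw [frac_zero, frac_zero, ← Nat.cast_succ, Nat.succ_eq_add_one, ofDyadic_natCast_succ]
  refine ⟨(), ?_⟩
  change ofDyadic _ = _
  congr 2
  push_cast
  ring

theorem exists_moveRight_intCast {n : ℤ} (hn : n < 0) :
    ∃ j, (ofDyadic (frac n 0)).moveRight j = ofDyadic (frac (n + 1) 0) := by
  have h := exists_moveLeft_intCast (Int.neg_pos_of_neg hn)
  rw [frac_neg, ofDyadic_neg, exists_moveLeft_neg (P := fun X => X = _)] at h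
  obtain ⟨j, hj⟩ := h
  refine ⟨j, ?_⟩
  rw [← Game.neg_neg (moveRight _ j), hj, ← ofDyadic_neg, ← frac_neg]
  congr 2
  ring

theorem exists_moveLeft_odd {l : ℤ} {m : ℕ} :
    ∃ i, (ofDyadic (frac (2 * l + 1) (m + 1))).moveLeft i = ofDyadic (frac (2 * l) (m + 1)) := by
  rw [frac_two_mul, ofDyadic_odd]
  exact ⟨(), rfl⟩

theorem exists_moveRight_odd {l : ℤ} {m : ℕ} : ∃ i,
    (ofDyadic (frac (2 * l + 1) (m + 1))).moveRight i = ofDyadic (frac (2 * (l + 1)) (m + 1)) := by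
  rw [frac_two_mul, ofDyadic_odd]
  exact ⟨(), rfl⟩

/-- The arithmetic behind the additivity of canonical forms: in a sum below a number, one of the
players has a move in which the gap is respected. -/
theorem exists_move_of_add_lt {k l n : ℤ} {m : ℕ} (h : k + l < n) :
    (∃ i n', (ofDyadic (frac n m)).moveLeft i = ofDyadic (frac n' m) ∧ k + l ≤ n') ∨
    (∃ j k', (ofDyadic (frac k m)).moveRight j = ofDyadic (frac k' m) ∧ k' + l ≤ n) ∨
    (∃ j l', (ofDyadic (frac l m)).moveRight j = ofDyadic (frac l' m) ∧ k + l' ≤ n) := by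
  induction m generalizing k l n with
  | zero =>
    by_cases hn : 0 < n
    · obtain ⟨i, hi⟩ := exists_moveLeft_intCast hn
      exact Or.inl ⟨i, _, hi, by omega⟩
    by_cases hk : k < 0
    · obtain ⟨i, hi⟩ := exists_moveRight_intCast hk
      exact Or.inr (Or.inl ⟨i, _, hi, by omega⟩)
    · obtain ⟨i, hi⟩ := exists_moveRight_intCast (show l < 0 by omega)
      exact Or.inr (Or.inr ⟨i, _, hi, by omega⟩)
  | succ m ih =>
    rcases Int.even_or_odd' n with ⟨n, rfl | rfl⟩
    · rcases Int.even_or_odd' k with ⟨k, rfl | rfl⟩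
      · rcases Int.even_or_odd' l with ⟨l, rfl | rfl⟩
        · rcases ih (show k + l < n by omega) with ⟨i, a, hi, ha⟩ | ⟨i, a, hi, ha⟩ | ⟨i, a, hi, ha⟩
          · refine Or.inl ?_
            rw [frac_two_mul]
            exact ⟨i, 2 * a, by rw [frac_two_mul, hi], by omega⟩
          · refine Or.inr (Or.inl ?_)
            rw [frac_two_mul]
            exact ⟨i, 2 * a, by rw [frac_two_mul, hi], by omega⟩
          · refine Or.inr (Or.inr ?_)
            rw [frac_two_mul]
            exact ⟨i, 2 * a, by rw [frac_two_mul, hi], by omega⟩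
        · obtain ⟨i, hi⟩ := exists_moveRight_odd (l := l) (m := m)
          exact Or.inr (Or.inr ⟨i, _, hi, by omega⟩)
      · obtain ⟨i, hi⟩ := exists_moveRight_odd (l := k) (m := m)
        exact Or.inr (Or.inl ⟨i, _, hi, by omega⟩)
    · obtain ⟨i, hi⟩ := exists_moveLeft_odd (l := n) (m := m)
      exact Or.inl ⟨i, _, hi, by omega⟩

/-- Over a common denominator, every move in a canonical form worsens the number for its mover, so
the weak inequality reduces to strict ones. A strict inequality reduces to a weak one by the move
from `exists_move_of_add_lt`. -/
theorem ofDyadic_add_aux (m n : ℕ) (x y z : ℤ)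
    (hn : (ofDyadic (frac x m)).birthday + (ofDyadic (frac y m)).birthday +
      (ofDyadic (frac z m)).birthday ≤ n) :
    (x + y ≤ z → ofDyadic (frac x m) + ofDyadic (frac y m) ≤ ofDyadic (frac z m)) ∧
    (x + y < z → ¬ ofDyadic (frac z m) ≤ ofDyadic (frac x m) + ofDyadic (frac y m)) := by
  induction n using Nat.strong_induction_on generalizing x y z with
  | h n ih =>
    constructor
    · intro h
      rw [le_def, forall_moveLeft_add (P := fun X => ¬ _ ≤ X)]
      refine ⟨⟨fun i => ?_, fun i => ?_⟩, fun j => ?_⟩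
      · obtain ⟨x', hx', hi⟩ := moveLeft_ofDyadic x m i
        have := birthday_moveLeft _ i
        rw [hi] at this ⊢
        exact (ih _ (by omega) x' y z le_rfl).2 (by omega)
      · obtain ⟨y', hy', hi⟩ := moveLeft_ofDyadic y m i
        have := birthday_moveLeft _ i
        rw [hi] at this ⊢
        exact (ih _ (by omega) x y' z le_rfl).2 (by omega)
      · obtain ⟨z', hz', hi⟩ := moveRight_ofDyadic z m j
        have := birthday_moveRight _ j
        rw [hi] at this ⊢
        exact (ih _ (by omega) x y z' le_rfl).2 (by omega)
    · intro h
      rw [not_le_iff, exists_moveRight_add (P := fun X => X ≤ _)]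
      rcases exists_move_of_add_lt (m := m) h with ⟨i, a, hi, ha⟩ | ⟨i, a, hi, ha⟩ | ⟨i, a, hi, ha⟩
      · refine Or.inl ⟨i, ?_⟩
        have := birthday_moveLeft _ i
        rw [hi] at this ⊢
        exact (ih _ (by omega) x y a le_rfl).1 ha
      · refine Or.inr (Or.inl ⟨i, ?_⟩)
        have := birthday_moveRight _ i
        rw [hi] at this ⊢
        exact (ih _ (by omega) a y z le_rfl).1 ha
      · refine Or.inr (Or.inr ⟨i, ?_⟩)
        have := birthday_moveRight _ i
        rw [hi] at this ⊢
        exact (ih _ (by omega) x a z le_rfl).1 ha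

/-- The value of the number `x`. -/
noncomputable def num (x : Dy) : Val := (ofDyadic x).val

theorem val_ofDyadic (x : Dy) : (ofDyadic x).val = num x := rfl

theorem num_neg (x : Dy) : num (-x) = -num x := by
  rw [num, ofDyadic_neg]; rfl

theorem num_zero : num 0 = 0 := by
  rw [num, ofDyadic_zero]; rfl

theorem exists_eq_frac₂ (x y : Dy) : ∃ k l m, x = frac k m ∧ y = frac l m := by
  obtain ⟨k, m, rfl⟩ := exists_eq_frac x
  obtain ⟨l, n, rfl⟩ := exists_eq_frac y
  obtain ⟨k', hk⟩ := exists_frac_of_le k (le_max_left m n)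
  obtain ⟨l', hl⟩ := exists_frac_of_le l (le_max_right m n)
  exact ⟨k', l', _, hk, hl⟩

theorem num_add_le (x y : Dy) : num x + num y ≤ num (x + y) := by
  obtain ⟨k, l, m, rfl, rfl⟩ := exists_eq_frac₂ x y
  rw [← frac_add]
  exact (ofDyadic_add_aux m _ k l _ le_rfl).1 le_rfl

theorem num_add (x y : Dy) : num (x + y) = num x + num y := by
  refine le_antisymm ?_ (num_add_le x y)
  -- The reverse inequality is the same one for the negatives.
  have h := num_add_le (-x) (-y)
  rw [← neg_add, num_neg, num_neg, num_neg, ← neg_add, neg_le_neg_iff] at h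
  exact h

theorem num_sub (x y : Dy) : num (x - y) = num x - num y := by
  rw [sub_eq_add_neg, num_add, num_neg, sub_eq_add_neg]

theorem num_le_num {x y : Dy} : num x ≤ num y ↔ x ≤ y := by
  obtain ⟨k, l, m, rfl, rfl⟩ := exists_eq_frac₂ x y
  have h0 : num (frac 0 m) = 0 := by rw [frac, Int.cast_zero, zero_mul, num_zero]
  have h (k l) := ofDyadic_add_aux m _ k 0 l le_rfl
  simp only [add_zero, ← val_le_val, val_add, val_ofDyadic, h0] at h
  rw [frac_le_frac]
  constructor
  · intro h'
    by_contra hlt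
    exact (h l k).2 (by omega) h'
  · exact (h k l).1

theorem num_inj {x y : Dy} : num x = num y ↔ x = y := by
  rw [le_antisymm_iff, num_le_num, num_le_num, le_antisymm_iff]

theorem num_nsmul (n : ℕ) (x : Dy) : num (n * x) = n • num x := by
  induction n with
  | zero => rw [Nat.cast_zero, zero_mul, num_zero, zero_nsmul]
  | succ n ih => rw [succ_nsmul, ← ih, ← num_add]; congr 1; push_cast; ring

/-- Number avoidance: a game which is not equal to a multiple of `1 / 2 ^ m` is below such a
multiple as soon as Left has no good move in it. -/
theorem le_num_frac_iff {G : Game} {m : ℕ} (hG : ∀ k, G.val ≠ num (frac k m)) (k : ℤ) :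
    G.val ≤ num (frac k m) ↔ ∀ i, ¬ num (frac k m) ≤ (G.moveLeft i).val := by
  refine ⟨fun h => ((val_le_iff _ _).1 h).1, ?_⟩
  generalize hn : (ofDyadic (frac k m)).birthday = n
  induction n using Nat.strong_induction_on generalizing k with
  | h n ih =>
    intro h
    refine (val_le_iff _ _).2 ⟨h, fun j hj => ?_⟩
    -- A Right option of the number is a larger, simpler multiple. By induction `G` lies below it
    -- too, so if it were also at most `G` it would equal `G`.
    obtain ⟨l, hl, hi⟩ := moveRight_ofDyadic k m j
    have hb := birthday_moveRight _ j
    rw [hi] at hj hb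
    have hkl : num (frac k m) ≤ num (frac l m) := num_le_num.2 (frac_le_frac.2 hl.le)
    exact hG l (le_antisymm (ih _ (by omega) l rfl fun i hi' => h i (hkl.trans hi')) hj)

theorem exists_le_num_intCast (G : Game) : ∃ n : ℕ, G.val ≤ num n := by
  suffices ∀ n : ℕ, ∀ G : Game, G.birthday ≤ n → G.val ≤ num n from ⟨_, this _ G le_rfl⟩
  intro n
  induction n with
  | zero =>
    intro G hG
    refine (val_le_iff _ _).2 ⟨fun i => ?_, fun j => ?_⟩
    · have := birthday_moveLeft G i
      omega
    · revert j
      rw [Nat.cast_zero, ofDyadic_zero]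
      exact isEmptyElim
  | succ n ih =>
    intro G hG
    refine (val_le_iff _ _).2 ⟨fun i h => ?_, fun j => ?_⟩
    · have h1 := birthday_moveLeft G i
      have h2 := h.trans (ih (G.moveLeft i) (by omega))
      rw [val_ofDyadic, num_le_num, Nat.cast_le] at h2
      omega
    · revert j
      rw [← Int.cast_natCast, ofDyadic_natCast_succ]
      exact fun j => (j : Empty).elim

end Game

/-! ### Maxima and minima of finite families -/

theorem exists_eq_minOf {ι : Type} [Finite ι] [h : Nonempty ι] (f : ι → Dy) :
    ∃ i, f i = minOf f := by
  let _ := Fintype.ofFinite ι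
  rw [minOf, dif_pos h]
  obtain ⟨i, -, hi⟩ := Finset.exists_mem_eq_inf' (Finset.univ_nonempty_iff.mpr h) f
  exact ⟨i, hi.symm⟩

theorem minOf_le {ι : Type} [Finite ι] (f : ι → Dy) (i : ι) : minOf f ≤ f i := by
  have h : Nonempty ι := ⟨i⟩
  let _ := Fintype.ofFinite ι
  rw [minOf, dif_pos h]
  exact Finset.inf'_le f (Finset.mem_univ i)

theorem le_minOf_iff {ι : Type} [Finite ι] [Nonempty ι] {f : ι → Dy} {c : Dy} :
    c ≤ minOf f ↔ ∀ i, c ≤ f i := by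
  obtain ⟨i, hi⟩ := exists_eq_minOf f
  exact ⟨fun h i => h.trans (minOf_le f i), fun h => hi ▸ h i⟩

theorem exists_eq_maxOf {ι : Type} [Finite ι] [h : Nonempty ι] (f : ι → Dy) :
    ∃ i, f i = maxOf f := by
  let _ := Fintype.ofFinite ι
  rw [maxOf, dif_pos h]
  obtain ⟨i, -, hi⟩ := Finset.exists_mem_eq_sup' (Finset.univ_nonempty_iff.mpr h) f
  exact ⟨i, hi.symm⟩

theorem le_maxOf {ι : Type} [Finite ι] (f : ι → Dy) (i : ι) : f i ≤ maxOf f := by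
  have h : Nonempty ι := ⟨i⟩
  let _ := Fintype.ofFinite ι
  rw [maxOf, dif_pos h]
  exact Finset.le_sup' f (Finset.mem_univ i)

theorem maxOf_le_iff {ι : Type} [Finite ι] [Nonempty ι] {f : ι → Dy} {c : Dy} :
    maxOf f ≤ c ↔ ∀ i, f i ≤ c := by
  obtain ⟨i, hi⟩ := exists_eq_maxOf f
  exact ⟨fun h i => (le_maxOf f i).trans h, fun h => hi ▸ h i⟩

theorem neg_maxOf {ι : Type} [Finite ι] (f : ι → Dy) :
    -maxOf f = minOf fun i => -f i := by
  by_cases h : Nonempty ι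
  · refine le_antisymm (le_minOf_iff.2 fun i => neg_le_neg (le_maxOf f i)) ?_
    obtain ⟨i, hi⟩ := exists_eq_maxOf f
    rw [← hi]
    exact minOf_le _ i
  · rw [maxOf, minOf, dif_neg h, dif_neg h, neg_zero]

theorem neg_minOf {ι : Type} [Finite ι] (f : ι → Dy) :
    -minOf f = maxOf fun i => -f i := by
  rw [eq_comm, ← neg_neg (maxOf _), neg_maxOf]
  simp only [neg_neg]

/-! ### Piecewise linear functions of slopes `0` and `1` -/

theorem frac_succ (k : ℤ) (m : ℕ) : frac (k + 1) m = frac k m + mesh m := by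
  rw [frac_add, frac_one]

/-- `f` is linear of slope `0` or `1` on the intervals between successive multiples of `1 / 2 ^ m`,
and its values at these multiples are again multiples of `1 / 2 ^ m`. -/
def IsGrid (m : ℕ) (f : Dy → Dy) : Prop :=
  ∀ k : ℤ, ∃ j e : ℤ, (e = 0 ∨ e = 1) ∧
    ∀ t, frac k m ≤ t → t ≤ frac (k + 1) m → f t = frac j m + e * (t - frac k m)

/-- Monotone functions which grow at most as fast as the identity. -/
def IsSlow (f : Dy → Dy) : Prop :=
  ∀ s t, s ≤ t → f s ≤ f t ∧ f t ≤ f s + (t - s)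

/-- The function equal to `f` up to `s`, and constant from `s` on. -/
noncomputable def freeze (f : Dy → Dy) (s t : Dy) : Dy := f (min t s)

/-- The lower envelope of the functions `t ↦ t - f i t`. -/
noncomputable def flipMin {ι : Type} [Finite ι] (f : ι → Dy → Dy) (t : Dy) : Dy :=
  minOf fun i => t - f i t

theorem isGrid_intCast (m : ℕ) (n : ℤ) : IsGrid m fun _ => n := fun k => by
  obtain ⟨l, hl⟩ := exists_frac_of_le n (Nat.zero_le m)
  exact ⟨l, 0, Or.inl rfl, fun t _ _ => by rw [← hl, frac_zero]; push_cast; ring⟩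

theorem IsGrid.freeze {m : ℕ} {f : Dy → Dy} (hf : IsGrid m f) (k₀ : ℤ) :
    IsGrid m (freeze f (frac k₀ m)) := by
  intro k
  rcases lt_or_ge k k₀ with h | h
  · obtain ⟨j, e, he, hj⟩ := hf k
    refine ⟨j, e, he, fun t h₁ h₂ => ?_⟩
    rw [CGT.freeze, min_eq_left (h₂.trans (frac_le_frac.2 h)), hj t h₁ h₂]
  · obtain ⟨j, e, he, hj⟩ := hf k₀
    refine ⟨j, 0, Or.inl rfl, fun t h₁ _ => ?_⟩
    rw [CGT.freeze, min_eq_right ((frac_le_frac.2 h).trans h₁),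
      hj _ le_rfl (frac_le_frac.2 (by omega))]
    push_cast
    ring

/-- Inside a cell no two of the lines cross: their values at the left end are equal or at least one
mesh apart, and their slopes differ by at most `1`. So a single index attains the minimum on the
whole cell. -/
theorem IsGrid.flipMin {ι : Type} [Finite ι] [Nonempty ι] {m : ℕ} {f : ι → Dy → Dy}
    (hf : ∀ i, IsGrid m (f i)) : IsGrid m (flipMin f) := by
  intro k
  choose j e he hj using fun i => hf i k
  -- As `e` is `0` or `1`, maximizing `2 * j + e` is maximizing `(j, e)` lexicographically: highest
  -- start first, then steepest slope.
  obtain ⟨i₀, hi₀⟩ := Finite.exists_min fun i => -(2 * j i + e i)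
  refine ⟨k - j i₀, 1 - e i₀, by rcases he i₀ with h | h <;> simp [h], fun t h₁ h₂ => ?_⟩
  have key : t - f i₀ t = frac (k - j i₀) m + ((1 - e i₀ : ℤ) : Dy) * (t - frac k m) := by
    rw [hj i₀ t h₁ h₂, sub_eq_add_neg k, frac_add, frac_neg]
    push_cast
    ring
  rw [← key]
  refine le_antisymm (minOf_le _ i₀) (le_minOf_iff.2 fun i => ?_)
  rw [hj i t h₁ h₂, hj i₀ t h₁ h₂]
  rw [frac_succ] at h₂
  have hle : j i ≤ j i₀ := by
    have := hi₀ i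
    rcases he i with h | h <;> rcases he i₀ with h' | h' <;> omega
  rcases hle.lt_or_eq with hlt | heq
  · have hlt' : frac (j i) m + mesh m ≤ frac (j i₀) m := by
      rw [← frac_succ]; exact frac_le_frac.2 hlt
    rcases he i with h | h <;> rcases he i₀ with h' | h' <;> rw [h, h'] <;> push_cast <;> linarith
  · have hee : e i ≤ e i₀ := by have := hi₀ i; omega
    rw [heq]
    rcases he i with h | h <;> rcases he i₀ with h' | h' <;> rw [h, h'] <;> push_cast <;> linarith

theorem isSlow_const (c : Dy) : IsSlow fun _ => c := fun s t h => ⟨le_rfl, by linarith⟩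

theorem IsSlow.freeze {f : Dy → Dy} (hf : IsSlow f) (s : Dy) : IsSlow (freeze f s) := by
  intro a b h
  have h₁ := hf (min a s) (min b s) (min_le_min_right s h)
  refine ⟨h₁.1, h₁.2.trans (add_le_add_right ?_ _)⟩
  rcases le_total a s with h₂ | h₂
  · rw [min_eq_left h₂]
    linarith [min_le_left b s]
  · rw [min_eq_right h₂, min_eq_right (h₂.trans h)]
    linarith

theorem IsSlow.flipMin {ι : Type} [Finite ι] [Nonempty ι] {f : ι → Dy → Dy}
    (hf : ∀ i, IsSlow (f i)) : IsSlow (flipMin f) := by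
  intro s t h
  constructor
  · refine le_minOf_iff.2 fun i => (minOf_le _ i).trans ?_
    linarith [(hf i s t h).2]
  · rw [← sub_le_iff_le_add]
    refine le_minOf_iff.2 fun i => ?_
    rw [sub_le_iff_le_add]
    refine (minOf_le _ i).trans ?_
    linarith [(hf i s t h).1]

/-- The dyadic rationals are not complete, so no intermediate value theorem is available. Here `f +
g` has slope `0`, `1` or `2` on each cell and multiples of `1 / 2 ^ m` as values at grid points, so
its first zero is a grid point or the midpoint of a cell. -/
theorem exists_isLeast_zero {m : ℕ} {f g : Dy → Dy} (hf : IsGrid m f) (hg : IsGrid m g)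
    (hf' : IsSlow f) (hg' : IsSlow g) {a b : Dy} (ha : f a + g a < 0) (hb : 0 ≤ f b + g b) :
    ∃ k : ℤ, a < frac k (m + 1) ∧ IsLeast {t | f t + g t = 0} (frac k (m + 1)) := by
  have mono {s t : Dy} (h : s ≤ t) : f s + g s ≤ f t + g t :=
    add_le_add (hf' s t h).1 (hg' s t h).1
  have lt_of {s t : Dy} (h : f s + g s < f t + g t) : s < t :=
    lt_of_not_ge fun h' => (mono h').not_gt h
  obtain ⟨A, hA⟩ : ∃ A : ℤ, frac A m ≤ a := by
    obtain ⟨k, l, rfl⟩ := exists_eq_frac a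
    refine ⟨-|k| * 2 ^ m, ?_⟩
    rw [← Subtype.coe_le_coe, coe_frac, coe_frac]
    push_cast
    rw [mul_div_assoc, div_self (by positivity), mul_one, le_div_iff₀ (by positivity)]
    have h1 : (1 : ℚ) ≤ 2 ^ l := one_le_pow₀ (by norm_num)
    nlinarith [neg_abs_le (k : ℚ), abs_nonneg (k : ℚ)]
  obtain ⟨B, hB⟩ : ∃ B : ℤ, b ≤ frac B m := by
    obtain ⟨k, l, rfl⟩ := exists_eq_frac b
    refine ⟨|k| * 2 ^ m, ?_⟩
    rw [← Subtype.coe_le_coe, coe_frac, coe_frac]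
    push_cast
    rw [mul_div_assoc, div_self (by positivity), mul_one, div_le_iff₀ (by positivity)]
    have h1 : (1 : ℚ) ≤ 2 ^ l := one_le_pow₀ (by norm_num)
    nlinarith [le_abs_self (k : ℚ), abs_nonneg (k : ℚ)]
  -- The zero lies in the cell that ends at the first grid point where the sum is non-negative.
  obtain ⟨k, hk, hmin⟩ := Int.exists_least_of_bdd
    (P := fun k => 0 ≤ f (frac k m) + g (frac k m))
    ⟨A, fun z hz => (frac_lt_frac.1 (hA.trans_lt (lt_of (ha.trans_le hz)))).le⟩
    ⟨B, hb.trans (mono hB)⟩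
  have hpre : f (frac (k - 1) m) + g (frac (k - 1) m) < 0 := by
    by_contra! h
    have := hmin _ h
    omega
  obtain ⟨j₁, e₁, he₁, h₁⟩ := hf (k - 1)
  obtain ⟨j₂, e₂, he₂, h₂⟩ := hg (k - 1)
  rw [sub_add_cancel] at h₁ h₂
  have hcell : frac k m = frac (k - 1) m + mesh m := by
    rw [← frac_succ, sub_add_cancel]
  have hle : frac (k - 1) m ≤ frac k m := frac_le_frac.2 (by omega)
  have hsum : ∀ t, frac (k - 1) m ≤ t → t ≤ frac k m →
      f t + g t = frac (j₁ + j₂) m + ((e₁ + e₂ : ℤ) : Dy) * (t - frac (k - 1) m) := by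
    intro t ht ht'
    rw [h₁ t ht ht', h₂ t ht ht', frac_add]
    push_cast
    ring
  have hj : j₁ + j₂ < 0 := by
    rw [hsum _ le_rfl hle, sub_self, mul_zero, add_zero] at hpre
    rw [← frac_lt_frac (m := m)]
    simpa [frac] using hpre
  have hj' : 0 ≤ (j₁ + j₂) + (e₁ + e₂) := by
    rw [hsum _ hle le_rfl, hcell, add_sub_cancel_left] at hk
    rw [← frac_le_frac (m := m), frac_add _ (e₁ + e₂)]
    simpa [frac] using hk
  -- The slope on this cell is positive, since the sum rises from a negative to a non-negative
  -- value; hence any zero in the cell is the least one.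
  have finish : ∀ s, frac (k - 1) m ≤ s → s ≤ frac k m → f s + g s = 0 →
      a < s ∧ IsLeast {t | f t + g t = 0} s := by
    intro s hs hs' h0
    refine ⟨lt_of (h0 ▸ ha), h0, fun t (ht : f t + g t = 0) => ?_⟩
    by_contra! hlt
    have hlt' : frac (k - 1) m ≤ t := (lt_of (ht ▸ hpre)).le
    rw [hsum t hlt' (hlt.le.trans hs')] at ht
    rw [hsum s hs hs'] at h0
    have he : (0 : Dy) < ((e₁ + e₂ : ℤ) : Dy) := by
      rw [Int.cast_pos]; omega
    nlinarith
  have hmesh := mesh_succ m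
  have hpos := mesh_pos (m + 1)
  -- Slope `2` from height minus one mesh vanishes at the midpoint; in all other cases the zero is
  -- the right end.
  have hcases : (e₁ + e₂ = 2 ∧ j₁ + j₂ = -1) ∨ (e₁ + e₂ = -(j₁ + j₂)) := by omega
  rcases hcases with ⟨he, hj⟩ | he
  · refine ⟨2 * (k - 1) + 1, ?_⟩
    have hs : frac (2 * (k - 1) + 1) (m + 1) = frac (k - 1) m + mesh (m + 1) := by
      rw [frac_succ, frac_two_mul]
    refine finish _ (by rw [hs]; linarith) (by rw [hs, hcell]; linarith) ?_
    rw [hsum _ (by rw [hs]; linarith) (by rw [hs, hcell]; linarith), hs, he, hj, frac_neg,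
      frac_one, hmesh]
    push_cast
    ring
  · refine ⟨2 * k, ?_⟩
    rw [frac_two_mul]
    refine finish _ hle le_rfl ?_
    rw [hsum _ hle le_rfl, hcell, he, frac]
    push_cast
    ring

/-- The functions which occur as trajectories: slow, bounded above, and piecewise linear on all
sufficiently fine grids. -/
structure IsTrajectory (f : Dy → Dy) : Prop where
  slow : IsSlow f
  bdd : ∃ B, ∀ t, f t ≤ B
  grid : ∃ M, ∀ m, M ≤ m → IsGrid m f

theorem isTrajectory_intCast (n : ℤ) : IsTrajectory fun _ => n :=
  ⟨isSlow_const _, ⟨n, fun _ => le_rfl⟩, 0, fun m _ => isGrid_intCast m n⟩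

theorem exists_forall_le_of_finite {ι α : Type} [Finite ι] [LinearOrder α] [Nonempty α]
    (f : ι → α) : ∃ B, ∀ i, f i ≤ B := by
  obtain ⟨B, hB⟩ := (Set.finite_range f).bddAbove
  exact ⟨B, fun i => hB ⟨i, rfl⟩⟩

/-- Used with `f = ρ(G^L)` and `g = -λ(G^R)`: the lower envelopes are then `-λ̃` and `ρ̃`, and a
zero of their sum is a meeting point. Boundedness of `f` and `g` makes the sum non-negative for
large `t`. The freezing point may need a grid finer by one step, hence the `M` in `IsTrajectory`. -/
theorem exists_freeze {ι κ : Type} [Finite ι] [Finite κ] [Nonempty ι] [Nonempty κ]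
    {f : ι → Dy → Dy} {g : κ → Dy → Dy} (hf : ∀ i, IsTrajectory (f i))
    (hg : ∀ i, IsTrajectory (g i)) {a : Dy} (ha : flipMin f a + flipMin g a < 0) :
    ∃ s, a < s ∧ IsLeast {t | flipMin f t + flipMin g t = 0} s ∧
      IsTrajectory (freeze (flipMin f) s) ∧ IsTrajectory (freeze (flipMin g) s) := by
  choose Bf hBf using fun i => (hf i).bdd
  choose Bg hBg using fun i => (hg i).bdd
  choose Mf hMf using fun i => (hf i).grid
  choose Mg hMg using fun i => (hg i).grid
  obtain ⟨bf, hbf⟩ := exists_forall_le_of_finite Bf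
  obtain ⟨bg, hbg⟩ := exists_forall_le_of_finite Bg
  obtain ⟨mf, hmf⟩ := exists_forall_le_of_finite Mf
  obtain ⟨mg, hmg⟩ := exists_forall_le_of_finite Mg
  have gf (m : ℕ) (hm : max mf mg ≤ m) : IsGrid m (flipMin f) :=
    IsGrid.flipMin fun i => hMf i m ((hmf i).trans ((le_max_left _ _).trans hm))
  have gg (m : ℕ) (hm : max mf mg ≤ m) : IsGrid m (flipMin g) :=
    IsGrid.flipMin fun i => hMg i m ((hmg i).trans ((le_max_right _ _).trans hm))
  have sf : IsSlow (flipMin f) := IsSlow.flipMin fun i => (hf i).slow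
  have sg : IsSlow (flipMin g) := IsSlow.flipMin fun i => (hg i).slow
  have hb : 0 ≤ flipMin f (max bf bg) + flipMin g (max bf bg) := by
    refine add_nonneg (le_minOf_iff.2 fun i => ?_) (le_minOf_iff.2 fun i => ?_)
    · exact sub_nonneg.2 ((hBf i _).trans ((hbf i).trans (le_max_left _ _)))
    · exact sub_nonneg.2 ((hBg i _).trans ((hbg i).trans (le_max_right _ _)))
  obtain ⟨k, hk, hleast⟩ := exists_isLeast_zero (gf _ le_rfl) (gg _ le_rfl) sf sg ha hb
  have traj (h : Dy → Dy) (hs : IsSlow h) (hgr : ∀ m, max mf mg ≤ m → IsGrid m h) :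
      IsTrajectory (freeze h (frac k (max mf mg + 1))) := by
    refine ⟨hs.freeze _, ⟨h (frac k (max mf mg + 1)), fun t => (hs _ _ (min_le_right _ _)).1⟩,
      max mf mg + 1, fun m hm => ?_⟩
    obtain ⟨l, hl⟩ := exists_frac_of_le k hm
    rw [hl]
    exact (hgr m (by omega)).freeze l
  exact ⟨_, hk, hleast, traj _ sf gf, traj _ sg gg⟩

namespace Game

/-! ### Trajectories, one step of the recursion -/

/-- The trajectory `t ↦ λ_t(G)`. -/
noncomputable def lam (G : Game) : Dy → Dy := G.thermo.lam

/-- The trajectory `t ↦ ρ_t(G)`. -/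
noncomputable def rho (G : Game) : Dy → Dy := G.thermo.rho

/-- The function `λ̃_t(G)` before freezing. -/
noncomputable def lamPre (G : Game) (t : Dy) : Dy := maxOf fun i => (G.moveLeft i).rho t - t

/-- The function `ρ̃_t(G)` before freezing. -/
noncomputable def rhoPre (G : Game) (t : Dy) : Dy := minOf fun j => (G.moveRight j).lam t + t

theorem ofInt_equiv_iff {G : Game} {n : ℤ} : G ≈ ofInt n ↔ G.val = num n := by
  rw [← ofDyadic_intCast, ← val_eq_val, num]

theorem thermo_of_int {G : Game} {n : ℤ} (h : G.val = num n) :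
    G.thermo = { lam := fun _ => n, rho := fun _ => n, cooled := fun _ => ofInt n, temp := ⊥ } := by
  have hex : ∃ n : ℤ, G ≈ ofInt n := ⟨n, ofInt_equiv_iff.2 h⟩
  have hn : hex.choose = n := by
    have h' := ofInt_equiv_iff.1 hex.choose_spec
    rw [h, num_inj, Int.cast_inj] at h'
    exact h'.symm
  cases G
  rw [thermo, dif_pos hex, hn]

theorem thermo_of_isLeast {G : Game} (h : ∀ n : ℤ, G.val ≠ num n) {s : Dy}
    (hs : IsLeast {t | G.lamPre t = G.rhoPre t} s) :
    G.lam = freeze G.lamPre s ∧ G.rho = freeze G.rhoPre s ∧ G.temp = s ∧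
      ∀ t, s < t → G.cool t = ofDyadic (G.lamPre s) := by
  have hex : ¬ ∃ n : ℤ, G ≈ ofInt n := fun ⟨n, hn⟩ => h n (ofInt_equiv_iff.1 hn)
  have hex' : ∃ s, IsLeast {t | G.lamPre t = G.rhoPre t} s := ⟨s, hs⟩
  have hc : hex'.choose = s := hex'.choose_spec.unique hs
  have heq : G.lamPre s = G.rhoPre s := hs.1
  cases G with
  | mk α β hα hβ L R =>
    have key := thermo.eq_1 α β hα hβ L R
    rw [dif_neg hex] at key
    replace key := key.trans (dif_pos hex')
    refine ⟨?_, ?_, ?_, ?_⟩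
    · rw [lam, key]
      funext t
      change (if t ≤ hex'.choose then _ else lamPre (mk α β hα hβ L R) hex'.choose) = _
      rw [hc, freeze]
      split_ifs with ht
      · rw [min_eq_left ht]; rfl
      · rw [min_eq_right (le_of_not_ge ht)]
    · rw [rho, key]
      funext t
      change (if t ≤ hex'.choose then _ else lamPre (mk α β hα hβ L R) hex'.choose) = _
      rw [hc, freeze]
      split_ifs with ht
      · rw [min_eq_left ht]; rfl
      · rw [min_eq_right (le_of_not_ge ht), heq]
    · rw [temp, key]
      change (hex'.choose : WithBot Dy) = _
      rw [hc]
    · intro t ht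
      rw [cool, key]
      change (if t ≤ hex'.choose then _ else ofDyadic (lamPre (mk α β hα hβ L R) hex'.choose)) = _
      rw [hc, if_neg ht.not_ge]

/-! ### Multiples of `1 / 2 ^ m` as bounds -/

/-- At `t = -1 / 2 ^ m`, the right trajectory is the largest multiple of `1 / 2 ^ m` below `G`. -/
def IsFloor (m : ℕ) (G : Game) : Prop :=
  (∃ a, G.rho (-mesh m) = frac a m) ∧
    ∀ k, num (frac k m) ≤ G.val ↔ frac k m ≤ G.rho (-mesh m)

/-- At `t = -1 / 2 ^ m`, the left trajectory is the least multiple of `1 / 2 ^ m` above `G`. -/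
def IsCeil (m : ℕ) (G : Game) : Prop :=
  (∃ a, G.lam (-mesh m) = frac a m) ∧
    ∀ k, G.val ≤ num (frac k m) ↔ G.lam (-mesh m) ≤ frac k m

/-- By number avoidance a multiple of the mesh bounds `G` from above iff it exceeds the floor of
every `G^L`, that is, iff it is at least each floor plus one mesh. Subtracting `t = -1 / 2 ^ m` adds
exactly this mesh. -/
theorem lamPre_mesh {G : Game} {m : ℕ} (hG : ∀ k, G.val ≠ num (frac k m)) [Nonempty G.LeftMoves]
    (h : ∀ i, IsFloor m (G.moveLeft i)) :
    (∃ a, G.lamPre (-mesh m) = frac a m) ∧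
      ∀ k, G.val ≤ num (frac k m) ↔ G.lamPre (-mesh m) ≤ frac k m := by
  constructor
  · obtain ⟨i, hi⟩ := exists_eq_maxOf fun i => (G.moveLeft i).rho (-mesh m) - -mesh m
    obtain ⟨a, ha⟩ := (h i).1
    refine ⟨a + 1, ?_⟩
    rw [lamPre, ← hi, ha, frac_succ, sub_neg_eq_add]
  · intro k
    rw [le_num_frac_iff hG, lamPre, maxOf_le_iff]
    refine forall_congr' fun i => ?_
    obtain ⟨a, ha⟩ := (h i).1
    rw [(h i).2, ha, not_le, sub_neg_eq_add, ← frac_succ, frac_lt_frac, frac_le_frac,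
      Int.add_one_le_iff]

theorem rhoPre_mesh {G : Game} {m : ℕ} (hG : ∀ k, G.val ≠ num (frac k m)) [Nonempty G.RightMoves]
    (h : ∀ j, IsCeil m (G.moveRight j)) :
    (∃ a, G.rhoPre (-mesh m) = frac a m) ∧
      ∀ k, num (frac k m) ≤ G.val ↔ frac k m ≤ G.rhoPre (-mesh m) := by
  constructor
  · obtain ⟨i, hi⟩ := exists_eq_minOf fun i => (G.moveRight i).lam (-mesh m) + -mesh m
    obtain ⟨a, ha⟩ := (h i).1
    refine ⟨a - 1, ?_⟩
    rw [rhoPre, ← hi, ha, ← sub_eq_add_neg, sub_eq_iff_eq_add, ← frac_succ, sub_add_cancel]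
  · intro k
    have hG' : ∀ k, (-G).val ≠ num (frac k m) := fun k hk => hG (-k) <| by
      rw [frac_neg, num_neg, ← hk, val_neg, neg_neg]
    have h' := le_num_frac_iff hG' (-k)
    rw [frac_neg, num_neg, val_neg, neg_le_neg_iff] at h'
    rw [h', forall_moveLeft_neg (P := fun X => ¬ -num (frac k m) ≤ X.val), rhoPre, le_minOf_iff]
    refine forall_congr' fun j => ?_
    obtain ⟨a, ha⟩ := (h j).1
    rw [val_neg, neg_le_neg_iff, (h j).2, ha, not_le, ← sub_eq_add_neg, le_sub_iff_add_le,
      ← frac_succ, frac_lt_frac, frac_le_frac, Int.add_one_le_iff]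

/-- Without Left options, number avoidance would put `G` below every integer, but `G` is bounded
below. -/
theorem nonempty_leftMoves {G : Game} (hG : ∀ n : ℤ, G.val ≠ num n) : Nonempty G.LeftMoves := by
  by_contra h
  rw [not_nonempty_iff] at h
  have h₁ := le_num_frac_iff (m := 0) (fun k => by rw [frac_zero]; exact hG k)
  obtain ⟨n, hn⟩ := exists_le_num_intCast (-G)
  have h₂ := (h₁ (-n - 1)).2 isEmptyElim
  rw [val_neg, neg_le, ← num_neg] at hn
  have h₃ := num_le_num.1 (hn.trans h₂)
  rw [frac_zero] at h₃
  push_cast at h₃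
  linarith

theorem nonempty_rightMoves {G : Game} (hG : ∀ n : ℤ, G.val ≠ num n) :
    Nonempty G.RightMoves := by
  have h := nonempty_leftMoves (G := -G) fun n hn => hG (-n) <| by
    rw [Int.cast_neg, num_neg, ← hn, val_neg, neg_neg]
  rw [← exists_true_iff_nonempty] at h ⊢
  exact (exists_moveLeft_neg (P := fun _ => True)).1 h

/-! ### The temperature exists -/

/-- What is shown about the trajectories of a game by induction. -/
structure IsRegular (G : Game) : Prop where
  rho_traj : IsTrajectory G.rho
  lam_traj : IsTrajectory fun t => -G.lam t
  floor : IsFloor 0 G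
  ceil : IsCeil 0 G
  exists_temp : (∀ n : ℤ, G.val ≠ num n) → ∃ s, -1 < s ∧ IsLeast {t | G.lamPre t = G.rhoPre t} s

theorem lam_of_int {G : Game} {n : ℤ} (h : G.val = num n) (t : Dy) : G.lam t = n := by
  rw [lam, thermo_of_int h]

theorem rho_of_int {G : Game} {n : ℤ} (h : G.val = num n) (t : Dy) : G.rho t = n := by
  rw [rho, thermo_of_int h]

theorem temp_of_int {G : Game} {n : ℤ} (h : G.val = num n) : G.temp = ⊥ := by
  rw [temp, thermo_of_int h]

/-- The parts need each other: the trajectories of the options, with their floors and ceilings at `t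
= -1`, give the temperature of `G`, and freezing there gives the trajectories of `G`. -/
theorem isRegular (G : Game) : G.IsRegular := by
  induction G using Game.induction with
  | h G ihL ihR =>
    by_cases hG : ∃ n : ℤ, G.val = num n
    · obtain ⟨n, hn⟩ := hG
      have hl : G.lam = fun _ => (n : Dy) := funext (lam_of_int hn)
      have hr : G.rho = fun _ => (n : Dy) := funext (rho_of_int hn)
      refine ⟨?_, ?_, ⟨?_, fun k => ?_⟩, ⟨?_, fun k => ?_⟩, fun h => absurd hn (h n)⟩
      · rw [hr]; exact isTrajectory_intCast n
      · rw [hl]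
        have := isTrajectory_intCast (-n)
        rwa [Int.cast_neg] at this
      · exact ⟨n, by rw [hr, frac_zero]⟩
      · rw [hr, hn, num_le_num]
      · exact ⟨n, by rw [hl, frac_zero]⟩
      · rw [hl, hn, num_le_num]
    · push Not at hG
      have hG' : ∀ k, G.val ≠ num (frac k 0) := fun k => by rw [frac_zero]; exact hG k
      have neL := nonempty_leftMoves hG
      have neR := nonempty_rightMoves hG
      obtain ⟨⟨a, ha⟩, ha'⟩ := lamPre_mesh hG' fun i => (ihL i).floor
      obtain ⟨⟨b, hb⟩, hb'⟩ := rhoPre_mesh hG' fun j => (ihR j).ceil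
      have hl : flipMin (fun i => (G.moveLeft i).rho) = fun t => -G.lamPre t := by
        funext t
        rw [lamPre, neg_maxOf, flipMin]
        simp only [neg_sub]
      have hr : flipMin (fun j t => -(G.moveRight j).lam t) = G.rhoPre := by
        funext t
        rw [rhoPre, flipMin]
        simp only [sub_neg_eq_add, add_comm]
      -- At `t = -1` the values `ρ̃` and `λ̃` are the integer floor and ceiling of `G`, which differ
      -- because `G` is not an integer.
      have hab : flipMin (fun i => (G.moveLeft i).rho) (-mesh 0) +
          flipMin (fun j t => -(G.moveRight j).lam t) (-mesh 0) < 0 := by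
        rw [hl, hr, neg_add_lt_iff_lt_add, add_zero]
        have h₁ := (ha' a).2 ha.le
        have h₂ := (hb' b).2 hb.ge
        rw [ha, hb]
        refine lt_of_le_of_ne (num_le_num.1 (h₂.trans h₁)) fun h => hG' a (le_antisymm h₁ ?_)
        rwa [← h]
      obtain ⟨s, hs, hleast, hlt, hrt⟩ := exists_freeze (fun i => (ihL i).rho_traj)
        (fun j => (ihR j).lam_traj) hab
      have hset : {t | flipMin (fun i => (G.moveLeft i).rho) t +
          flipMin (fun j t => -(G.moveRight j).lam t) t = 0} = {t | G.lamPre t = G.rhoPre t} := by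
        ext t
        rw [hl, hr, Set.mem_ofPred_eq, Set.mem_ofPred_eq, neg_add_eq_zero]
      rw [hset] at hleast
      obtain ⟨e₁, e₂, -, -⟩ := thermo_of_isLeast hG hleast
      rw [hl] at hlt
      rw [hr] at hrt
      have hm : min (-mesh 0) s = -mesh 0 := min_eq_left hs.le
      refine ⟨?_, ?_, ?_, ?_, fun _ => ⟨s, ?_, hleast⟩⟩
      · rw [e₂]; exact hrt
      · rw [e₁]; exact hlt
      · rw [IsFloor, e₂, freeze, hm]; exact ⟨⟨b, hb⟩, hb'⟩
      · rw [IsCeil, e₁, freeze, hm]; exact ⟨⟨a, ha⟩, ha'⟩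
      · rwa [mesh_zero] at hs

/-- The shape of the trajectories of a game which is not an integer. -/
theorem exists_temp {G : Game} (hG : ∀ n : ℤ, G.val ≠ num n) :
    ∃ s : Dy, -1 < s ∧ IsLeast {t | G.lamPre t = G.rhoPre t} s ∧ G.temp = s ∧
      (∀ t, G.lam t = G.lamPre (min t s)) ∧ (∀ t, G.rho t = G.rhoPre (min t s)) ∧
      ∀ t, s < t → G.cool t = ofDyadic (G.lamPre s) := by
  obtain ⟨s, hs, hleast⟩ := G.isRegular.exists_temp hG
  obtain ⟨e₁, e₂, e₃, e₄⟩ := thermo_of_isLeast hG hleast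
  exact ⟨s, hs, hleast, e₃, fun t => by rw [e₁, freeze], fun t => by rw [e₂, freeze], e₄⟩

theorem rho_slow {G : Game} {s t : Dy} (h : s ≤ t) :
    G.rho s ≤ G.rho t ∧ G.rho t ≤ G.rho s + (t - s) :=
  G.isRegular.rho_traj.slow s t h

theorem lam_slow {G : Game} {s t : Dy} (h : s ≤ t) :
    G.lam t ≤ G.lam s ∧ G.lam s ≤ G.lam t + (t - s) := by
  have := G.isRegular.lam_traj.slow s t h
  constructor <;> linarith [this.1, this.2]

theorem lamPre_anti {G : Game} {s t : Dy} (h : s ≤ t) : G.lamPre t ≤ G.lamPre s := by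
  by_cases hne : Nonempty G.LeftMoves
  · refine maxOf_le_iff.2 fun i => le_trans ?_ (le_maxOf _ i)
    linarith [(rho_slow (G := G.moveLeft i) h).2]
  · rw [lamPre, lamPre, maxOf, maxOf, dif_neg hne, dif_neg hne]

theorem rhoPre_mono {G : Game} {s t : Dy} (h : s ≤ t) : G.rhoPre s ≤ G.rhoPre t := by
  by_cases hne : Nonempty G.RightMoves
  · refine le_minOf_iff.2 fun i => (minOf_le _ i).trans ?_
    linarith [(lam_slow (G := G.moveRight i) h).2]
  · rw [rhoPre, rhoPre, minOf, minOf, dif_neg hne, dif_neg hne]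

theorem rho_le_lam (G : Game) (t : Dy) : G.rho t ≤ G.lam t := by
  by_cases hG : ∃ n : ℤ, G.val = num n
  · obtain ⟨n, hn⟩ := hG
    rw [lam_of_int hn, rho_of_int hn]
  · push Not at hG
    obtain ⟨s, -, hleast, -, hl, hr, -⟩ := exists_temp hG
    rw [hl, hr]
    have h := min_le_right t s
    exact (rhoPre_mono h).trans ((le_of_eq hleast.1.symm).trans (lamPre_anti h))

theorem rho_eq_lam_of_temp_le {G : Game} {t : Dy} (h : G.temp ≤ t) : G.rho t = G.lam t := by
  by_cases hG : ∃ n : ℤ, G.val = num n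
  · obtain ⟨n, hn⟩ := hG
    rw [lam_of_int hn, rho_of_int hn]
  · push Not at hG
    obtain ⟨s, -, hleast, hs, hl, hr, -⟩ := exists_temp hG
    rw [hs, WithBot.coe_le_coe] at h
    rw [hl, hr, min_eq_right h]
    exact hleast.1.symm

theorem temp_le_of_rho_eq_lam {G : Game} {t : Dy} (h : G.rho t = G.lam t) : G.temp ≤ t := by
  by_cases hG : ∃ n : ℤ, G.val = num n
  · obtain ⟨n, hn⟩ := hG
    rw [temp_of_int hn]
    exact bot_le
  · push Not at hG
    obtain ⟨s, -, hleast, hs, hl, hr, -⟩ := exists_temp hG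
    rw [hl, hr] at h
    rw [hs, WithBot.coe_le_coe]
    exact (hleast.2 h.symm).trans (min_le_left _ _)

/-- From the temperature on, `ρ` and `λ` coincide, while one increases and the other decreases. -/
theorem lam_eq_of_temp_le {G : Game} {s t : Dy} (hs : G.temp ≤ s) (h : s ≤ t) :
    G.lam s = G.lam t := by
  have hG := rho_slow (G := G) h
  have hG' := lam_slow (G := G) h
  have h₁ := rho_eq_lam_of_temp_le hs
  have h₂ := rho_eq_lam_of_temp_le (hs.trans (WithBot.coe_le_coe.2 h))
  linarith [hG.1, hG'.1]

theorem cool_of_temp_lt {G : Game} {t : Dy} (h : G.temp < t) : G.cool t = ofDyadic (G.lam t) := by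
  by_cases hG : ∃ n : ℤ, G.val = num n
  · obtain ⟨n, hn⟩ := hG
    rw [cool, lam_of_int hn, thermo_of_int hn, ofDyadic_intCast]
  · push Not at hG
    obtain ⟨s, -, -, hs, hl, -, hc⟩ := exists_temp hG
    rw [hs, WithBot.coe_lt_coe] at h
    rw [hc t h, hl, min_eq_right h.le]

theorem rho_moveLeft_le {G : Game} {t : Dy} (ht : -1 ≤ t) (i : G.LeftMoves) :
    (G.moveLeft i).rho t ≤ G.lam t + t := by
  by_cases hG : ∃ n : ℤ, G.val = num n
  · obtain ⟨n, hn⟩ := hG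
    obtain ⟨⟨a, ha⟩, ha'⟩ := (G.moveLeft i).isRegular.floor
    -- For an integer `n` the bound is not part of the recursion. But `n ≤ G^L` fails, so the floor
    -- of `G^L` at `t = -1` is at most `n - 1`, and from there `ρ` grows with slope at most `1`.
    have h := (ha' n).not.1 (by rw [frac_zero, ← hn]; exact not_val_le_moveLeft G i)
    rw [mesh_zero] at ha h
    rw [ha, not_le, frac_lt_frac, ← Int.add_one_le_iff, ← frac_le_frac (m := 0), frac_succ,
      mesh_zero, ← ha, frac_zero] at h
    have h' := rho_slow (G := G.moveLeft i) ht
    rw [lam_of_int hn]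
    linarith [h'.2]
  · push Not at hG
    obtain ⟨s, -, -, -, hl, -⟩ := exists_temp hG
    have h₁ := lamPre_anti (G := G) (min_le_left t s)
    have h₂ := le_maxOf (fun i => (G.moveLeft i).rho t - t) i
    rw [hl]
    exact sub_le_iff_le_add.1 (h₂.trans h₁)

theorem exists_moveRight_of_le_temp {G : Game} {t : Dy} (ht : t ≤ G.temp) :
    ∃ j, (G.moveRight j).lam t + t = G.rho t := by
  by_cases hG : ∃ n : ℤ, G.val = num n
  · obtain ⟨n, hn⟩ := hG
    rw [temp_of_int hn, le_bot_iff] at ht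
    exact absurd ht WithBot.coe_ne_bot
  · push Not at hG
    have := nonempty_rightMoves hG
    obtain ⟨s, -, -, hs, -, hr, -⟩ := exists_temp hG
    rw [hs, WithBot.coe_le_coe] at ht
    rw [hr, min_eq_left ht]
    exact exists_eq_minOf _

/-! ### Games of negative temperature are numbers -/

theorem isFloor_and_isCeil (m : ℕ) (G : Game) : IsFloor m G ∧ IsCeil m G := by
  induction m generalizing G with
  | zero => exact ⟨G.isRegular.floor, G.isRegular.ceil⟩
  | succ m ihm =>
    induction G using Game.induction with
    | h G ihL ihR =>
      by_cases hG : ∃ k, G.val = num (frac k (m + 1))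
      · obtain ⟨k, hk⟩ := hG
        suffices h : G.rho (-mesh (m + 1)) = frac k (m + 1) ∧
            G.lam (-mesh (m + 1)) = frac k (m + 1) by
          refine ⟨⟨⟨k, h.1⟩, fun l => ?_⟩, ⟨⟨k, h.2⟩, fun l => ?_⟩⟩
          · rw [h.1, hk, num_le_num]
          · rw [h.2, hk, num_le_num]
        have hmesh := mesh_succ m
        have hpos := mesh_pos (m + 1)
        have hle : -mesh m ≤ -mesh (m + 1) := by linarith
        obtain ⟨⟨⟨b, hb⟩, hb'⟩, ⟨⟨a, ha⟩, ha'⟩⟩ := ihm G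
        rw [hk, ha] at ha'
        rw [hk, hb] at hb'
        simp only [num_le_num] at ha' hb'
        rcases Int.even_or_odd' k with ⟨l, rfl | rfl⟩
        -- An even numerator means that `G` lies on the coarser grid: the trajectories have already
        -- met at `-1 / 2 ^ m` and stay constant.
        · simp only [frac_two_mul] at hk ha' hb' ⊢
          have hal : G.lam (-mesh m) = frac l m :=
            ha.trans (le_antisymm ((ha' l).1 le_rfl) ((ha' a).2 le_rfl))
          have hbl : G.rho (-mesh m) = frac l m :=
            hb.trans (le_antisymm ((hb' b).2 le_rfl) ((hb' l).1 le_rfl))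
          have ht := temp_le_of_rho_eq_lam (hbl.trans hal.symm)
          have h₁ := lam_eq_of_temp_le ht hle
          have h₂ := rho_eq_lam_of_temp_le (ht.trans (WithBot.coe_le_coe.2 hle))
          rw [h₂, ← h₁]
          exact ⟨hal, hal⟩
        -- For an odd numerator `G` is the midpoint of a coarse cell, whose ends are the
        -- trajectories at `-1 / 2 ^ m`. As the slopes are at most `1` in size, `ρ` cannot have
        -- passed `G` from below by `-1 / 2 ^ (m + 1)`, nor `λ` from above.
        · have hal : a = l + 1 := by
            have h₁ := ha' (l + 1)
            have h₂ := ha' l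
            rw [← frac_two_mul _ m, frac_le_frac, frac_two_mul, frac_le_frac] at h₁ h₂
            omega
          have hbl : b = l := by
            have h₁ := hb' (l + 1)
            have h₂ := hb' l
            rw [← frac_two_mul _ m, frac_le_frac, frac_two_mul, frac_le_frac] at h₁ h₂
            omega
          have hnat : ∀ n : ℤ, G.val ≠ num n := by
            intro n hn
            rw [hk, num_inj, ← frac_zero] at hn
            obtain ⟨n', hn'⟩ := exists_frac_of_le n (Nat.zero_le m)
            rw [hn', ← frac_two_mul n'] at hn
            have h₁ := frac_le_frac.1 hn.le
            have h₂ := frac_le_frac.1 hn.ge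
            omega
          have neL := nonempty_leftMoves hnat
          have neR := nonempty_rightMoves hnat
          obtain ⟨s, -, hleast, htemp, hl, hr, -⟩ := exists_temp hnat
          have hsucc : frac (2 * l + 1) (m + 1) = frac l m + mesh (m + 1) := by
            rw [frac_succ, frac_two_mul]
          -- The opposite bounds, valid before freezing: no `G^L` is at least `G`, so its floor is
          -- at least one mesh lower.
          have hL : G.lamPre (-mesh (m + 1)) ≤ frac (2 * l + 1) (m + 1) := by
            refine maxOf_le_iff.2 fun i => ?_
            obtain ⟨⟨c, hc⟩, hc'⟩ := (ihL i).1
            have h := (hc' (2 * l + 1)).not.1 (hk ▸ not_val_le_moveLeft G i)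
            rw [hc, frac_le_frac, not_le] at h
            rw [hc, sub_neg_eq_add, ← frac_succ, frac_le_frac]
            exact h
          have hR : frac (2 * l + 1) (m + 1) ≤ G.rhoPre (-mesh (m + 1)) := by
            refine le_minOf_iff.2 fun j => ?_
            obtain ⟨⟨c, hc⟩, hc'⟩ := (ihR j).2
            have h := (hc' (2 * l + 1)).not.1 (hk ▸ not_val_moveRight_le G j)
            rw [hc, frac_le_frac, not_le] at h
            rw [hc, ← sub_eq_add_neg, le_sub_iff_add_le, ← frac_succ, frac_le_frac]
            exact h
          have h₁ := (lam_slow (G := G) hle).2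
          have h₂ := (rho_slow (G := G) hle).2
          rw [ha, hal, frac_succ] at h₁
          rw [hb, hbl] at h₂
          rcases le_or_gt s (-mesh (m + 1)) with hs | hs
          · have h₃ := rho_eq_lam_of_temp_le (htemp.le.trans (WithBot.coe_le_coe.2 hs))
            constructor <;> linarith
          · rw [hl, min_eq_left hs.le] at h₁ ⊢
            rw [hr, min_eq_left hs.le] at h₂ ⊢
            constructor <;> linarith
      · push Not at hG
        have hG' : ∀ n : ℤ, G.val ≠ num n := by
          intro n hn
          obtain ⟨k, hk⟩ := exists_frac_of_le n (Nat.zero_le (m + 1))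
          rw [← frac_zero, hk] at hn
          exact hG k hn
        have neL := nonempty_leftMoves hG'
        have neR := nonempty_rightMoves hG'
        obtain ⟨⟨a, ha⟩, ha'⟩ := lamPre_mesh hG fun i => (ihL i).1
        obtain ⟨⟨b, hb⟩, hb'⟩ := rhoPre_mesh hG fun j => (ihR j).2
        obtain ⟨s, -, hleast, -, hl, hr, -⟩ := exists_temp hG'
        -- Had the trajectories met earlier, the ceiling of `G` would be at most its floor, and `G`
        -- would lie on the grid.
        have hs : -mesh (m + 1) ≤ s := by
          by_contra! hlt
          have h₁ := lamPre_anti (G := G) hlt.le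
          have h₂ := rhoPre_mono (G := G) hlt.le
          have h₃ : G.lamPre s = G.rhoPre s := hleast.1
          have h₄ : frac a (m + 1) ≤ frac b (m + 1) := by rw [← ha, ← hb]; linarith
          refine hG b (le_antisymm ?_ ((hb' b).2 hb.ge))
          exact (ha' b).2 (ha.trans_le h₄)
        rw [IsFloor, IsCeil, hl, hr, min_eq_left hs]
        exact ⟨⟨⟨b, hb⟩, hb'⟩, ⟨⟨a, ha⟩, ha'⟩⟩

/-- A game of negative temperature is a number, namely its mast value. -/
theorem val_eq_num_of_temp_neg {G : Game} (h : G.temp < (0 : Dy)) {t : Dy} (ht : G.temp ≤ t) :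
    G.val = num (G.lam t) := by
  obtain ⟨m, hm⟩ : ∃ m, G.temp ≤ (-mesh m : Dy) := by
    by_cases hG : ∃ n : ℤ, G.val = num n
    · obtain ⟨n, hn⟩ := hG
      exact ⟨0, by rw [temp_of_int hn]; exact bot_le⟩
    · push Not at hG
      obtain ⟨s, -, -, hs, -⟩ := exists_temp hG
      rw [hs, WithBot.coe_lt_coe] at h
      obtain ⟨k, m, rfl⟩ := exists_eq_frac s
      -- A negative temperature `k / 2 ^ m` has `k ≤ -1`.
      refine ⟨m, ?_⟩
      rw [hs, WithBot.coe_le_coe, ← frac_one, ← frac_neg, frac_le_frac]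
      rw [frac, ← zero_mul (mesh m), mul_lt_mul_iff_left₀ (mesh_pos m), Int.cast_lt_zero] at h
      omega
  have hlt : G.lam t = G.lam (-mesh m) := by
    rcases le_total t (-mesh m) with h' | h'
    · exact lam_eq_of_temp_le ht h'
    · exact (lam_eq_of_temp_le hm h').symm
  obtain ⟨⟨-, hf⟩, ⟨⟨a, ha⟩, hc⟩⟩ := isFloor_and_isCeil m G
  have hr := rho_eq_lam_of_temp_le hm
  rw [hlt, ha]
  exact le_antisymm ((hc a).2 ha.le) ((hf a).2 (by rw [hr, ha]))

end Game

namespace Game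

/-! ### Negatives -/

theorem val_neg_eq_num_iff {G : Game} {x : Dy} : (-G).val = num x ↔ G.val = num (-x) := by
  rw [val_neg, num_neg, neg_eq_iff_eq_neg]

theorem lam_neg_and_temp_neg (G : Game) :
    (∀ t, (-G).lam t = -G.rho t) ∧ (∀ t, (-G).rho t = -G.lam t) ∧ (-G).temp = G.temp := by
  induction G using Game.induction with
  | h G ihL ihR =>
    by_cases hG : ∃ n : ℤ, G.val = num n
    · obtain ⟨n, hn⟩ := hG
      have hn' : (-G).val = num ((-n : ℤ) : Dy) := by
        rw [val_neg_eq_num_iff, Int.cast_neg, neg_neg, hn]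
      refine ⟨fun t => ?_, fun t => ?_, ?_⟩
      · rw [lam_of_int hn', rho_of_int hn, Int.cast_neg]
      · rw [rho_of_int hn', lam_of_int hn, Int.cast_neg]
      · rw [temp_of_int hn', temp_of_int hn]
    · push Not at hG
      have hG' : ∀ n : ℤ, (-G).val ≠ num n := fun n hn => hG (-n) <| by
        rw [Int.cast_neg, ← val_neg_eq_num_iff, hn]
      have hlp (t) : (-G).lamPre t = -G.rhoPre t := by
        cases G with
        | mk α β hα hβ L R =>
          rw [rhoPre, neg_minOf]
          refine congrArg maxOf (funext fun j => ?_)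
          exact (congrArg (· - t) ((ihR j).2.1 t)).trans (by rw [neg_add, sub_eq_add_neg])
      have hrp (t) : (-G).rhoPre t = -G.lamPre t := by
        cases G with
        | mk α β hα hβ L R =>
          rw [lamPre, neg_maxOf]
          refine congrArg minOf (funext fun j => ?_)
          exact (congrArg (· + t) ((ihL j).1 t)).trans (by rw [neg_sub, neg_add_eq_sub])
      obtain ⟨s, -, hs, hst, hl, hr, -⟩ := exists_temp hG
      obtain ⟨s', -, hs', hst', hl', hr', -⟩ := exists_temp hG'
      have hss : s' = s := by
        refine hs'.unique ?_
        have hset : {t | (-G).lamPre t = (-G).rhoPre t} = {t | G.lamPre t = G.rhoPre t} := by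
          ext t
          rw [Set.mem_ofPred_eq, Set.mem_ofPred_eq, hlp, hrp, neg_inj, eq_comm]
        rwa [hset]
      subst hss
      exact ⟨fun t => by rw [hl', hr, hlp], fun t => by rw [hr', hl, hrp], by rw [hst, hst']⟩

/-! ### Sums of several games -/

/-- Only Left options are recorded, since the sum is only ever tested on the smaller side of `≤`. -/
theorem exists_sum (M : Multiset Game) : ∃ S : Game, S.val = (M.map val).sum ∧
    ∀ i, ∃ G M', M = G ::ₘ M' ∧ ∃ i', (S.moveLeft i).val =
      (G.moveLeft i').val + (M'.map val).sum := by
  induction M using Multiset.induction with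
  | empty => exact ⟨0, rfl, isEmptyElim⟩
  | cons G M ih =>
    obtain ⟨S, hS, hi⟩ := ih
    refine ⟨G + S, by rw [val_add, hS, Multiset.map_cons, Multiset.sum_cons], ?_⟩
    rw [forall_moveLeft_add (P := fun X => ∃ G' M', G ::ₘ M = G' ::ₘ M' ∧ ∃ i',
      X.val = (G'.moveLeft i').val + (M'.map val).sum)]
    refine ⟨fun i => ⟨G, M, rfl, i, by rw [val_add, hS]⟩, fun i => ?_⟩
    obtain ⟨H, M', rfl, i', h⟩ := hi i
    refine ⟨H, G ::ₘ M', Multiset.cons_swap _ _ _, i', ?_⟩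
    rw [val_add, h, Multiset.map_cons, Multiset.sum_cons]
    abel

theorem sum_val_le {M : Multiset Game} {D : Game}
    (hL : ∀ G M', M = G ::ₘ M' → ∀ i, ¬ D.val ≤ (G.moveLeft i).val + (M'.map val).sum)
    (hR : ∀ j, ¬ (D.moveRight j).val ≤ (M.map val).sum) : (M.map val).sum ≤ D.val := by
  obtain ⟨S, hS, hi⟩ := exists_sum M
  rw [← hS, val_le_iff]
  refine ⟨fun i => ?_, by rwa [hS]⟩
  obtain ⟨G, M', hM, i', h⟩ := hi i
  rw [h]
  exact hL G M' hM i'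

theorem sum_num (M : Multiset Game) (f : Game → Dy) :
    (M.map fun G => num (f G)).sum = num (M.map f).sum := by
  induction M using Multiset.induction with
  | empty => exact num_zero.symm
  | cons G M ih => simp only [Multiset.map_cons, Multiset.sum_cons, num_add, ih]

/-- Both players' strategies in a sum of games: Left cannot gain more than `t + 1` over the sum of
the left trajectories, and Right answers in a hottest component. -/
theorem sum_bounds (n : ℕ) : ∀ M : Multiset Game, (M.map birthday).sum ≤ n → ∀ t y : Dy, 0 ≤ t →
    ((M.map fun G => G.lam t).sum + y ≤ 0 → (M.map val).sum + num y ≤ num (t + 1)) ∧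
    (∀ G M', M = G ::ₘ M' → G.rho t + (M'.map fun G => G.lam t).sum + y ≤ 0 →
      ¬ num 1 ≤ (M.map val).sum + num y) := by
  induction n using Nat.strong_induction_on with
  | h n ih =>
    intro M hM
    -- Right moves in a component that is not yet frozen at `t` and gains exactly `t`; the upper
    -- bound `t + 1` for the resulting sum then becomes `1`.
    have warm : ∀ t y : Dy, 0 ≤ t → ∀ G M', M = G ::ₘ M' → t ≤ G.temp →
        G.rho t + (M'.map fun G => G.lam t).sum + y ≤ 0 →
        ¬ num 1 ≤ (M.map val).sum + num y := by
      rintro t y ht G M' rfl htemp h hle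
      obtain ⟨j, hj⟩ := exists_moveRight_of_le_temp htemp
      have hb := birthday_moveRight G j
      simp only [Multiset.map_cons, Multiset.sum_cons] at hM hle
      have key := (ih (((G.moveRight j ::ₘ M').map birthday).sum) (by
        simp only [Multiset.map_cons, Multiset.sum_cons]; omega) _ le_rfl t (y + t) ht).1 (by
        simp only [Multiset.map_cons, Multiset.sum_cons]; linarith)
      simp only [Multiset.map_cons, Multiset.sum_cons] at key
      rw [num_add, num_add, add_comm (num t), ← add_assoc, add_le_add_iff_right] at key
      have := key.trans hle
      rw [add_le_add_iff_right, add_le_add_iff_right] at this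
      exact not_val_moveRight_le G j this
    have second : ∀ t y : Dy, 0 ≤ t → ∀ G M', M = G ::ₘ M' →
        G.rho t + (M'.map fun G => G.lam t).sum + y ≤ 0 →
        ¬ num 1 ≤ (M.map val).sum + num y := by
      intro t y ht G M' hGM h
      by_cases hG : t ≤ G.temp
      · exact warm t y ht G M' hGM hG h
      -- Beyond its temperature `G` has `ρ_t = λ_t`, so the designated component plays no role and
      -- Right may move anywhere.
      have hsum : (M.map fun G => G.lam t).sum + y ≤ 0 := by
        rw [hGM, Multiset.map_cons, Multiset.sum_cons,
          ← rho_eq_lam_of_temp_le (le_of_not_ge hG)]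
        exact h
      by_cases hex : ∃ H ∈ M, t ≤ H.temp
      · obtain ⟨H, hH, hHt⟩ := hex
        obtain ⟨M'', hM''⟩ := Multiset.exists_cons_of_mem hH
        refine warm t y ht H M'' hM'' hHt (le_trans ?_ hsum)
        rw [hM'', Multiset.map_cons, Multiset.sum_cons]
        linarith [rho_le_lam H t]
      push Not at hex
      by_cases hneg : ∀ H ∈ M, H.temp < (0 : Dy)
      · rw [Multiset.map_congr rfl fun H hH => val_eq_num_of_temp_neg (hneg H hH) (hex H hH).le,
          sum_num, ← num_add, num_le_num]
        intro h1
        linarith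
      · push Not at hneg
        obtain ⟨K, hK, hK0⟩ := hneg
        classical
        obtain ⟨H, hH, hmax⟩ := M.toFinset.exists_max_image temp ⟨K, Multiset.mem_toFinset.2 hK⟩
        simp only [Multiset.mem_toFinset] at hH hmax
        have h0 := hK0.trans (hmax K hK)
        obtain ⟨s, hs⟩ := WithBot.ne_bot_iff_exists.1
          (ne_bot_of_le_ne_bot WithBot.coe_ne_bot h0)
        have hst := hex H hH
        rw [← hs, WithBot.coe_lt_coe] at hst
        rw [← hs, WithBot.coe_le_coe] at h0
        -- Lowering `t` to the highest temperature `s ≥ 0` changes no `λ`, and the bound `1` to be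
        -- proved does not involve `t`. At `s` a hottest component is warm.
        rw [Multiset.map_congr rfl fun K hK =>
          (lam_eq_of_temp_le ((hmax K hK).trans hs.ge) hst.le).symm] at hsum
        obtain ⟨M'', hM''⟩ := Multiset.exists_cons_of_mem hH
        refine warm s y h0 H M'' hM'' hs.le (le_trans ?_ hsum)
        rw [hM'', Multiset.map_cons, Multiset.sum_cons]
        linarith [rho_le_lam H s]
    refine fun t y ht => ⟨fun h => ?_, second t y ht⟩
    -- The number `y` is moved to the right-hand side, so that Left has no moves in it and Right
    -- moves only in one canonical form.
    have key : (M.map val).sum ≤ (ofDyadic (t + 1 - y)).val := by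
      refine sum_val_le ?_ fun j => ?_
      · rintro G M' rfl i hle
        have hb := birthday_moveLeft G i
        simp only [Multiset.map_cons, Multiset.sum_cons] at hM h
        refine (ih (((G.moveLeft i ::ₘ M').map birthday).sum) (by
          simp only [Multiset.map_cons, Multiset.sum_cons]; omega) _ le_rfl t (y - t) ht).2 _ _ rfl
          ?_ ?_
        · linarith [rho_moveLeft_le (show -1 ≤ t by linarith) i]
        · rw [val_ofDyadic, show t + 1 - y = 1 - (y - t) by ring, num_sub, sub_le_iff_le_add] at hle
          rwa [Multiset.map_cons, Multiset.sum_cons]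
      · obtain ⟨k, m, hkm⟩ := exists_eq_frac (t + 1 - y)
        have hz : ∃ z, t + 1 - y < z ∧
            (ofDyadic (t + 1 - y)).moveRight j = ofDyadic z := by
          revert j
          rw [hkm]
          intro j
          obtain ⟨l, hl, hj⟩ := moveRight_ofDyadic k m j
          exact ⟨frac l m, frac_lt_frac.2 hl, hj⟩
        obtain ⟨z, hz, hj⟩ := hz
        rw [hj, val_ofDyadic]
        rcases M.empty_or_exists_mem with rfl | ⟨G, hG⟩
        · rw [Multiset.map_zero, Multiset.sum_zero, ← num_zero, num_le_num]
          rw [Multiset.map_zero, Multiset.sum_zero] at h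
          intro h'
          linarith
        · obtain ⟨M', hM'⟩ := Multiset.exists_cons_of_mem hG
          -- Right's move from `t + 1 - y` to a larger `z` is refuted by the second claim for the
          -- same `M`, with `1 - z < y - t ≤ y` in place of `y`.
          have h1 := second t (1 - z) ht G M' hM' (by
            rw [hM', Multiset.map_cons, Multiset.sum_cons] at h
            linarith [rho_le_lam G t])
          rwa [num_sub, add_sub_assoc', le_sub_iff_add_le, add_comm (num 1),
            add_le_add_iff_right] at h1
    rw [val_ofDyadic, num_sub, le_sub_iff_add_le] at key
    exact key

theorem nsmul_val_le {G : Game} {t : Dy} (ht : 0 ≤ t) (n : ℕ) :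
    n • G.val ≤ n • num (G.lam t) + num (t + 1) := by
  have h := (sum_bounds _ (Multiset.replicate n G) le_rfl t (-(n * G.lam t)) ht).1 (by
    simp)
  rw [Multiset.map_replicate, Multiset.sum_replicate, num_neg, num_nsmul, ← sub_eq_add_neg,
    sub_le_iff_le_add'] at h
  exact h

/-- The lower bound is the upper bound for `-G`, as `λ_t(-G) = -ρ_t(G) = -λ_t(G)` above the
temperature. For `t < 0` the game is a number and the difference vanishes, so any `c ≥ 0` serves. -/
theorem abs_nsmul_val_sub_le {G : Game} {t c : Dy} (ht : G.temp < t) (hc : 0 ≤ c)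
    (htc : 0 ≤ t → t + 1 ≤ c) (n : ℕ) :
    -num c ≤ n • G.val - n • num (G.lam t) ∧ n • G.val - n • num (G.lam t) ≤ num c := by
  rcases lt_or_ge t 0 with h | h
  · rw [val_eq_num_of_temp_neg (ht.trans (WithBot.coe_lt_coe.2 h)) ht.le, sub_self,
      neg_nonpos, ← num_zero, num_le_num]
    exact ⟨hc, hc⟩
  · have h₁ := nsmul_val_le (G := G) h n
    have h₂ := nsmul_val_le (G := -G) h n
    have hc' := num_le_num.2 (htc h)
    rw [(lam_neg_and_temp_neg G).1, rho_eq_lam_of_temp_le ht.le, val_neg, num_neg, smul_neg,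
      smul_neg, ← sub_le_iff_le_add', neg_sub_neg] at h₂
    refine ⟨?_, (sub_le_iff_le_add'.2 h₁).trans hc'⟩
    rw [neg_le, neg_sub]
    exact h₂.trans hc'

/-! ### Stops -/

theorem stops_of_num {G : Game} {x : Dy} (h : G.val = num x) : G.stops = (x, x) := by
  have hex : ∃ x : Dy, G ≈ ofDyadic x := ⟨x, val_eq_val.1 h⟩
  have hx : hex.choose = x := by
    have h' := val_eq_val.2 hex.choose_spec
    rw [h, val_ofDyadic, num_inj] at h'
    exact h'.symm
  cases G
  rw [stops, dif_pos hex, hx]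

theorem stops_of_not_num {G : Game} (h : ∀ x, G.val ≠ num x) :
    G.leftStop = maxOf (fun i => (G.moveLeft i).rightStop) ∧
      G.rightStop = minOf (fun j => (G.moveRight j).leftStop) := by
  have hex : ¬ ∃ x : Dy, G ≈ ofDyadic x := fun ⟨x, hx⟩ => h x (val_eq_val.2 hx)
  cases G
  rw [leftStop, rightStop, stops, dif_neg hex]
  exact ⟨rfl, rfl⟩

/-- The two claims alternate along the recursion: the first is for Left to move, the second for
Right to move. -/
theorem stops_le (G : Game) (d : Dy) :
    (G.val ≤ num d → G.leftStop ≤ d) ∧ (¬ num d ≤ G.val → G.rightStop ≤ d) := by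
  induction G using Game.induction generalizing d with
  | h G ihL ihR =>
    by_cases hG : ∃ x, G.val = num x
    · obtain ⟨x, hx⟩ := hG
      rw [leftStop, rightStop, stops_of_num hx, hx, num_le_num, num_le_num]
      exact ⟨id, fun h => (lt_of_not_ge h).le⟩
    · push Not at hG
      have neL := nonempty_leftMoves fun n => hG n
      have neR := nonempty_rightMoves fun n => hG n
      obtain ⟨hl, hr⟩ := stops_of_not_num hG
      constructor
      · intro h
        rw [hl, maxOf_le_iff]
        exact fun i => (ihL i d).2 (((val_le_iff _ _).1 h).1 i)
      · obtain ⟨k, m, rfl⟩ := exists_eq_frac d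
        generalize hn : (ofDyadic (frac k m)).birthday = n
        induction n using Nat.strong_induction_on generalizing k with
        | h n ih =>
          intro h
          -- If the reason is `G ≤ d^L`, the number `d` is replaced by the smaller and simpler
          -- `d^L`, which `G` cannot equal; otherwise some `G^R ≤ d` bounds the right stop.
          rcases (not_le_iff _ _).1 h with ⟨i, hi⟩ | ⟨j, hj⟩
          · obtain ⟨l, hl, h'⟩ := moveLeft_ofDyadic k m i
            have hb := birthday_moveLeft _ i
            rw [h'] at hi hb
            exact (ih _ (by omega) l rfl fun h'' => hG _ (le_antisymm hi h'')).trans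
              (frac_le_frac.2 hl.le)
          · rw [hr]
            exact (minOf_le _ j).trans ((ihR j _).1 hj)

theorem rightStop_le {G : Game} {d : Dy} (h : G.val ≤ num d) : G.rightStop ≤ d := by
  by_cases h' : num d ≤ G.val
  · rw [rightStop, stops_of_num (le_antisymm h h')]
  · exact (stops_le G d).2 h'

theorem stops_neg (G : Game) :
    (-G).leftStop = -G.rightStop ∧ (-G).rightStop = -G.leftStop := by
  induction G using Game.induction with
  | h G ihL ihR =>
    by_cases hG : ∃ x, G.val = num x
    · obtain ⟨x, hx⟩ := hG
      have hx' : (-G).val = num (-x) := by rw [val_neg_eq_num_iff, neg_neg, hx]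
      rw [leftStop, leftStop, rightStop, rightStop, stops_of_num hx, stops_of_num hx']
      exact ⟨rfl, rfl⟩
    · push Not at hG
      obtain ⟨hl, hr⟩ := stops_of_not_num hG
      obtain ⟨hl', hr'⟩ := stops_of_not_num (G := -G) fun x hx => hG _ (val_neg_eq_num_iff.1 hx)
      rw [hl, hr, hl', hr', neg_maxOf, neg_minOf]
      cases G
      exact ⟨congrArg maxOf (funext fun j => (ihR j).2), congrArg minOf (funext fun i => (ihL i).1)⟩

theorem stops_mem_Icc {G : Game} {a b : Dy} (ha : num a ≤ G.val) (hb : G.val ≤ num b) :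
    G.leftStop ∈ Set.Icc a b ∧ G.rightStop ∈ Set.Icc a b := by
  have ha' : (-G).val ≤ num (-a) := by rwa [val_neg, num_neg, neg_le_neg_iff]
  have h₁ := (stops_le _ _).1 ha'
  have h₂ := rightStop_le ha'
  rw [(stops_neg G).1, neg_le_neg_iff] at h₁
  rw [(stops_neg G).2, neg_le_neg_iff] at h₂
  exact ⟨⟨h₂, (stops_le _ _).1 hb⟩, ⟨h₁, rightStop_le hb⟩⟩

/-! ### Multiples of a game against multiples of the cooled game -/

theorem multiple_sub_multiple_cool {G : Game} {t c : Dy} (ht : G.temp < t) (hc : 0 ≤ c)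
    (htc : 0 ≤ t → t + 1 ≤ c) (n : ℕ) :
    -ofDyadic c ≤ multiple n G - multiple n (G.cool t) ∧
      multiple n G - multiple n (G.cool t) ≤ ofDyadic c := by
  rw [← val_le_val, ← val_le_val, val_neg, val_sub, val_multiple, val_multiple,
    cool_of_temp_lt ht, val_ofDyadic, val_ofDyadic]
  exact abs_nsmul_val_sub_le ht hc htc n

theorem stops_multiple_mem_Icc {G : Game} {t c : Dy} (ht : G.temp < t) (hc : 0 ≤ c)
    (htc : 0 ≤ t → t + 1 ≤ c) (n : ℕ) :
    (multiple n G).leftStop ∈ Set.Icc (n * G.lam t - c) (n * G.lam t + c) ∧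
      (multiple n G).rightStop ∈ Set.Icc (n * G.lam t - c) (n * G.lam t + c) := by
  obtain ⟨h₁, h₂⟩ := abs_nsmul_val_sub_le ht hc htc n
  rw [← num_nsmul] at h₁ h₂
  rw [neg_le_sub_iff_le_add', ← sub_le_iff_le_add'] at h₁
  rw [sub_le_iff_le_add'] at h₂
  refine stops_mem_Icc ?_ ?_
  · rwa [num_sub, val_multiple]
  · rwa [num_add, val_multiple]

end Game

/-! ### Limits and the mean value theorem -/

theorem tendsto_div_of_mem_Icc {u : ℕ → Dy} {x c : Dy}
    (h : ∀ n : ℕ, u n ∈ Set.Icc (n * x - c) (n * x + c)) :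
    Filter.Tendsto (fun n : ℕ => (((u n : Dy) : ℚ) : ℝ) / (n : ℝ)) Filter.atTop
      (nhds ((x : ℚ) : ℝ)) := by
  have hc : Filter.Tendsto (fun n : ℕ => ((c : ℚ) : ℝ) / (n : ℝ)) Filter.atTop (nhds 0) :=
    tendsto_const_div_atTop_nhds_zero_nat _
  have lower := hc.const_sub ((x : ℚ) : ℝ)
  have upper := hc.const_add ((x : ℚ) : ℝ)
  rw [sub_zero] at lower
  rw [add_zero] at upper
  refine tendsto_of_tendsto_of_tendsto_of_le_of_le' lower upper ?_ ?_
  · filter_upwards [Filter.eventually_gt_atTop 0] with n hn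
    have hn' : (0 : ℝ) < n := Nat.cast_pos.2 hn
    have h₁ : (((n * x - c : Dy) : ℚ) : ℝ) ≤ ((u n : ℚ) : ℝ) :=
      Rat.cast_le.2 (Subtype.coe_le_coe.2 (h n).1)
    push_cast at h₁
    rw [le_div_iff₀ hn', sub_mul, div_mul_cancel₀ _ hn'.ne']
    linarith
  · filter_upwards [Filter.eventually_gt_atTop 0] with n hn
    have hn' : (0 : ℝ) < n := Nat.cast_pos.2 hn
    have h₁ : ((u n : ℚ) : ℝ) ≤ (((n * x + c : Dy) : ℚ) : ℝ) :=
      Rat.cast_le.2 (Subtype.coe_le_coe.2 (h n).2)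
    push_cast at h₁
    rw [div_le_iff₀ hn', add_mul, div_mul_cancel₀ _ hn'.ne']
    linarith

end CGT

theorem corollary7p5 (G : CGT.Game) (t : CGT.Dy) (ht : G.temp < (t : WithBot CGT.Dy)) :
    (∃ x : CGT.Dy, G.cool t ≈ CGT.Game.ofDyadic x ∧
      Filter.Tendsto
        (fun n : ℕ => (((CGT.Game.multiple n G).leftStop : ℚ) : ℝ) / (n : ℝ))
        Filter.atTop (nhds ((x : ℚ) : ℝ)) ∧
      Filter.Tendsto
        (fun n : ℕ => (((CGT.Game.multiple n G).rightStop : ℚ) : ℝ) / (n : ℝ))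
        Filter.atTop (nhds ((x : ℚ) : ℝ))) ∧
    (∃ C : CGT.Dy, ∀ n : ℕ,
      -CGT.Game.ofDyadic C ≤ CGT.Game.multiple n G - CGT.Game.multiple n (G.cool t) ∧
      CGT.Game.multiple n G - CGT.Game.multiple n (G.cool t) ≤ CGT.Game.ofDyadic C) ∧
    (-1 ≤ t → ∀ n : ℕ,
      -CGT.Game.ofDyadic (t + 1) ≤ CGT.Game.multiple n G - CGT.Game.multiple n (G.cool t) ∧
      CGT.Game.multiple n G - CGT.Game.multiple n (G.cool t) ≤ CGT.Game.ofDyadic (t + 1)) := by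
  -- The constant `max t 0 + 1` is admissible for every `t`, also below `-1`, where `t + 1` would be
  -- negative.
  have hc : (0 : CGT.Dy) ≤ max t 0 + 1 := add_nonneg (le_max_right _ _) zero_le_one
  have htc (_ : 0 ≤ t) : t + 1 ≤ max t 0 + 1 := add_le_add_left (le_max_left _ _) _
  have stops := CGT.Game.stops_multiple_mem_Icc ht hc htc
  refine ⟨⟨G.lam t, ?_, CGT.tendsto_div_of_mem_Icc fun n => (stops n).1,
    CGT.tendsto_div_of_mem_Icc fun n => (stops n).2⟩,
    ⟨_, CGT.Game.multiple_sub_multiple_cool ht hc htc⟩,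
    fun h => CGT.Game.multiple_sub_multiple_cool ht (by linarith) fun _ => le_rfl⟩
  rw [CGT.Game.cool_of_temp_lt ht]
  exact ⟨CGT.Game.le_refl _, CGT.Game.le_refl _⟩
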